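/- Let $k\ge 1$, let $H>1/2$ and put $\alpha:=H-\frac k2-1$. Let $g$ be a nonzero measurable real function on $(0,\infty)^k$ with $g(c\mathbf x)=c^{\alpha}g(\mathbf x)$ for all $c>0$ and all $\mathbf x\in(0,\infty)^k$, where $-\frac{k+1}{2}<\alpha<-\frac k2$ (so that $\frac12<H<1$). Let $W$ be a Gaussian white noise on $\mathbb R$, that is, a centred Gaussian family indexed by the Borel sets of finite Lebesgue measure with $E[W(A)W(B)]=|A\cap B|$, and let $I_k$ denote the $k$-fold Wiener–Itô integral with respect to $W$. For $\lambda>0$ and $t\in\mathbb R$ put $$h^\lambda_t(\mathbf x)=\int_0^t g(s-x_1,\dots,s-x_k)\prod_{i=1}^k e^{-\lambda(s-x_i)}\,1_{\{s>x_1,\dots,s>x_k\}}\,ds$$ (an oriented integral if $t<0$). If, for every $t\in\mathbb R$, this integral converges absolutely for a.e. $\mathbf x$ and $h_t^\lambda\in L^2(\mathbb R^k)$, then the process $Z^\lambda(t)=I_k(h^\lambda_t)$, $t\in\mathbb R$, is called the tempered generalized Hermite process (it is determined up to modification). Fix $\lambda>0$. (a) If $$\int_{(0,\infty)^k}|g(\mathbf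 x)\,g(\mathbf 1+\mathbf x)|\,e^{-2\lambda u(x_1+\dots+x_k)}\,d\mathbf x<\infty\qquad\text{for all }u\ge 0,$$ then the process $Z^{c\lambda}$ is well defined for every $c>0$. (b) Whenever $Z^\lambda$ is well defined, in particular under the condition in (a), it has stationary increments: for every $h\in\mathbb R$, the processes $\{Z^\lambda(t+h)-Z^\lambda(h)\}_{t\in\mathbb R}$ and $\{Z^\lambda(t)-Z^\lambda(0)\}_{t\in\mathbb R}$ have the same finite-dimensional distributions. Moreover, for every $c>0$ for which $Z^{c\lambda}$ is well defined, the scaling property $$\{Z^\lambda(ct)\}_{t\in\mathbb R}\overset{d}{=}\{c^{H}Z^{c\lambda}(t)\}_{t\in\mathbb R}$$ holds in the sense of finite-dimensional distributions. -/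

import Mathlib

open MeasureTheory ProbabilityTheory Filter Topology

noncomputable section

namespace TemperedHermite

/-! ### Gaussian white noise on the line and multiple Wiener-Itô integrals -/

/-- `W` is a Gaussian random measure on `ℝ` with Lebesgue control measure: the family `W A`, indexed
by the Borel sets `A` of finite Lebesgue measure, is a centred Gaussian process with covariance
`E[W A * W B] = |A ∩ B|`. (Values of `W` at other sets are irrelevant.) -/
structure IsWhiteNoise {Ω : Type*} [MeasurableSpace Ω] (P : Measure Ω) (W : Set ℝ → Ω → ℝ) :
    Prop where
  gaussian : IsGaussianProcess
    (fun A : {A : Set ℝ // MeasurableSet A ∧ volume A ≠ ⊤} => W A.1) P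
  mean : ∀ A : Set ℝ, MeasurableSet A → volume A ≠ ⊤ → P[W A] = 0
  cov : ∀ A B : Set ℝ, MeasurableSet A → volume A ≠ ⊤ → MeasurableSet B → volume B ≠ ⊤ →
    P[fun ω => W A ω * W B ω] = volume.real (A ∩ B)

/-- Data of an elementary kernel on `ℝ^k` vanishing on the diagonals: pairwise disjoint Borel sets
`A 0, …, A (n-1)` of finite measure and coefficients `a (i₁, …, i_k)` that vanish as soon as two of
the indices coincide. -/
structure ElemKernel (k : ℕ) where
  n : ℕ
  A : Fin n → Set ℝ
  measurableSet_A : ∀ j, MeasurableSet (A j)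
  volume_A : ∀ j, volume (A j) ≠ ⊤
  disjoint_A : Pairwise fun i j => Disjoint (A i) (A j)
  a : (Fin k → Fin n) → ℝ
  a_diag : ∀ i : Fin k → Fin n, ¬ Function.Injective i → a i = 0

/-- The function `∑ a (i₁, …, i_k) 1_{A i₁ × ⋯ × A i_k}` on `ℝ^k`. -/
def ElemKernel.toFun {k : ℕ} (φ : ElemKernel k) (x : Fin k → ℝ) : ℝ :=
  ∑ i : Fin k → Fin φ.n, φ.a i * ∏ l : Fin k, (φ.A (i l)).indicator (fun _ => (1 : ℝ)) (x l)

/-- The elementary integral `∑ a (i₁, …, i_k) W (A i₁) ⋯ W (A i_k)`. -/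
def ElemKernel.integral {k : ℕ} {Ω : Type*} (W : Set ℝ → Ω → ℝ) (φ : ElemKernel k) (ω : Ω) : ℝ :=
  ∑ i : Fin k → Fin φ.n, φ.a i * ∏ l : Fin k, W (φ.A (i l)) ω

/-- `Y` is (a version of) the `k`-fold Wiener-Itô integral `I_k(f)` of `f ∈ L²(ℝ^k)`: the
`L²(Ω)`-limit of the elementary integrals of elementary kernels that converge to `f` in
`L²(ℝ^k)`. -/
def IsWienerIntegral {k : ℕ} {Ω : Type*} [MeasurableSpace Ω] (P : Measure Ω)
    (W : Set ℝ → Ω → ℝ) (f : (Fin k → ℝ) → ℝ) (Y : Ω → ℝ) : Prop :=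
  MemLp f 2 volume ∧ MemLp Y 2 P ∧
    ∃ φ : ℕ → ElemKernel k,
      Tendsto (fun m => eLpNorm (fun x => (φ m).toFun x - f x) 2 volume) atTop (𝓝 0) ∧
      Tendsto (fun m => eLpNorm (fun ω => (φ m).integral W ω - Y ω) 2 P) atTop (𝓝 0)

/-! ### Generalized Hermite kernels and the tempered process -/

/-- The positive orthant of `ℝ^k`. -/
def orthant (k : ℕ) : Set (Fin k → ℝ) := {x | ∀ i, 0 < x i}

/-- A nonzero measurable function on the positive orthant, homogeneous of degree `α`, where
`-(k+1)/2 < α < -k/2`. Values of `g` outside the orthant are irrelevant. -/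
structure IsHermiteKernel (k : ℕ) (α : ℝ) (g : (Fin k → ℝ) → ℝ) : Prop where
  lower : -((k : ℝ) + 1) / 2 < α
  upper : α < -(k : ℝ) / 2
  measurable : Measurable (fun x : orthant k => g x.1)
  nonzero : ∃ x ∈ orthant k, g x ≠ 0
  homogeneous : ∀ c : ℝ, 0 < c → ∀ x ∈ orthant k, g (fun i => c * x i) = c ^ α * g x

/-- The integrability condition on the kernel:
`∫ |g(x) g(1 + x)| exp(-2 λ u (x₁ + ⋯ + x_k)) dx < ∞` over the positive orthant, for `u ≥ 0`. -/
def TemperedIntegrable (k : ℕ) (lam : ℝ) (g : (Fin k → ℝ) → ℝ) : Prop :=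
  ∀ u : ℝ, 0 ≤ u →
    ∫⁻ x in orthant k,
      ENNReal.ofReal (|g x * g (fun i => 1 + x i)| * Real.exp (-2 * lam * u * ∑ i, x i)) < ⊤

/-- The integrand `g(s - x₁, …, s - x_k) ∏ exp(-λ (s - x_i)) 1_{s > x₁, …, s > x_k}`. -/
def temperedIntegrand {k : ℕ} (g : (Fin k → ℝ) → ℝ) (lam : ℝ) (x : Fin k → ℝ) (s : ℝ) : ℝ :=
  (orthant k).indicator (fun y => g y * ∏ i, Real.exp (-lam * y i)) (fun i => s - x i)

/-- The kernel `h_t^λ(x) = ∫_0^t g(s - x) ∏ exp(-λ (s - x_i)) 1_{s > x} ds` (oriented integral). -/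
def temperedKernel {k : ℕ} (g : (Fin k → ℝ) → ℝ) (lam t : ℝ) (x : Fin k → ℝ) : ℝ :=
  ∫ s in (0 : ℝ)..t, temperedIntegrand g lam x s

/-- `Z` is (a version of) the tempered generalized Hermite process `Z^λ(t) = I_k(h_t^λ)`, `t ∈ ℝ`,
driven by `W`: the integral defining `h_t^λ(x)` converges absolutely for almost all `x`, and
`Z t` is the `k`-fold Wiener-Itô integral of `h_t^λ`. -/
def IsTemperedHermiteProcess {k : ℕ} {Ω : Type*} [MeasurableSpace Ω] (P : Measure Ω)
    (W : Set ℝ → Ω → ℝ) (g : (Fin k → ℝ) → ℝ) (lam : ℝ) (Z : ℝ → Ω → ℝ) : Prop :=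
  ∀ t : ℝ,
    (∀ᵐ x : Fin k → ℝ, IntervalIntegrable (temperedIntegrand g lam x) volume 0 t) ∧
      IsWienerIntegral P W (temperedKernel g lam t) (Z t)

/-! ### Distributional properties of processes -/

/-- Equality of all finite-dimensional distributions. -/
def EqFDD {Ω : Type*} [MeasurableSpace Ω] (P : Measure Ω) (X Y : ℝ → Ω → ℝ) : Prop :=
  ∀ I : Finset ℝ, IdentDistrib (fun ω (t : I) => X t ω) (fun ω (t : I) => Y t ω) P P

/-- Stationary increments: for every `h`, the processes `t ↦ X(t + h) - X(h)` and
`t ↦ X(t) - X(0)` have the same finite-dimensional distributions. -/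
def HasStationaryIncrements {Ω : Type*} [MeasurableSpace Ω] (P : Measure Ω) (X : ℝ → Ω → ℝ) :
    Prop :=
  ∀ h : ℝ, EqFDD P (fun t ω => X (t + h) ω - X h ω) (fun t ω => X t ω - X 0 ω)

end TemperedHermite

end

/-!
# Existence, stationary increments and scaling of tempered generalized Hermite processes

Everything about the law of `I_k(f)` reduces to elementary kernels, where it is a statement about
finitely many values of the white noise. Two facts make the reduction possible. First, elementary
kernels are dense in `L²(ℝ^k)` (`ElemKernel.exists_tendsto`): a continuous compactly supported
function is sampled on a fine grid, the boxes meeting a diagonal are dropped, and the diagonals are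
null. Second, the elementary integral is bounded from `L²(ℝ^k)` to `L²(P)`
(`ElemKernel.eLpNorm_integral_le`): values of `W` on disjoint sets are independent, so the products
of such values over distinct sets of indices are orthogonal. The differences of elementary kernels
are handled by passing to the common atoms of their sides (`ElemKernel.exists_eq_sub`). Hence `I_k`
exists, is linear, and may be computed along any approximating sequence
(`IsWienerIntegral.tendsto`).

If `S y = r y + d` with `r > 0`, then `A ↦ W (S⁻¹ A)` and `A ↦ r^{-1/2} W A` are centred Gaussian
with the same covariance, so the elementary integrals of `φ ∘ S` and of `φ` agree in law, jointly in
finitely many kernels, up to the factor `r^{-k/2}`. Passing to the limit in distribution gives the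
same for `I_k` (`identDistrib_wienerIntegral_affine`). Both parts of (b) are instances of this: the
increment `h_{t+h} - h_h` is the translate by `h` of `h_t` (`temperedKernel_add_sub`), and by
homogeneity of `g` the kernel `h_{ct}` with parameter `λ` is `c^{α+1}` times the dilation by `c` of
`h_t` with parameter `cλ` (`IsHermiteKernel.temperedKernel_mul`); the exponents add up to
`α + 1 + k/2 = H`.

For (a), the exponential factor is at most one on the orthant, so the kernel is dominated by the
untempered one. By Tonelli, the square of the `L²` norm of the latter is a double integral over
`(s, s')` of the correlation of `g` at lag `|s' - s|`, which by homogeneity equals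
`|s' - s|^{2α+k}` times the constant in the integrability condition at `u = 0`
(`IsHermiteKernel.lintegral_mul`), and `2α + k > -1`.
-/

noncomputable section

namespace TemperedHermite

/-! ### White noise on disjoint sets -/

section WhiteNoise

variable {Ω : Type*} [MeasurableSpace Ω] {P : Measure Ω} {W : Set ℝ → Ω → ℝ}

theorem IsWhiteNoise.memLp [IsProbabilityMeasure P] (hW : IsWhiteNoise P W) {A : Set ℝ}
    (hA : MeasurableSet A) (hA' : volume A ≠ ⊤) {p : ENNReal} (hp : p ≠ ⊤) : MemLp (W A) p P :=
  (hW.gaussian.hasGaussianLaw_eval ⟨A, hA, hA'⟩).memLp hp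

/-- White noise is almost surely finitely additive: the difference of the two sides is orthogonal in
`L²(P)` to every `W B`, hence to itself. -/
theorem IsWhiteNoise.ae_eq_sum [IsProbabilityMeasure P] (hW : IsWhiteNoise P W) {ι : Type*}
    (s : Finset ι) {C : ι → Set ℝ}
    (hC : ∀ i ∈ s, MeasurableSet (C i)) (hC' : ∀ i ∈ s, volume (C i) ≠ ⊤)
    (hd : (s : Set ι).PairwiseDisjoint C) :
    W (⋃ i ∈ s, C i) =ᵐ[P] fun ω => ∑ i ∈ s, W (C i) ω := by
  set U := ⋃ i ∈ s, C i with hU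
  have hUm : MeasurableSet U := s.measurableSet_biUnion hC
  have hUf : volume U ≠ ⊤ := (measure_biUnion_lt_top s.finite_toSet
    fun i hi => (hC' i hi).lt_top).ne
  have hL : MemLp (fun ω => W U ω - ∑ i ∈ s, W (C i) ω) 2 P :=
    (hW.memLp hUm hUf (by simp)).sub
      (memLp_finsetSum s fun i hi => hW.memLp (hC i hi) (hC' i hi) (by simp))
  -- The difference is orthogonal to every `W B`, by additivity of Lebesgue measure.
  have key : ∀ B, MeasurableSet B → volume B ≠ ⊤ →
      ∫ ω, (W U ω - ∑ i ∈ s, W (C i) ω) * W B ω ∂P = 0 := by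
    intro B hB hB'
    have hi : ∀ A, MeasurableSet A → volume A ≠ ⊤ → Integrable (fun ω => W A ω * W B ω) P :=
      fun A hA hA' => (hW.memLp hA hA' (p := 2) (by simp)).integrable_mul
        (hW.memLp hB hB' (p := 2) (by simp))
    simp only [sub_mul, Finset.sum_mul]
    rw [integral_sub (hi U hUm hUf) (integrable_finsetSum s fun i h => hi _ (hC i h) (hC' i h)),
      integral_finsetSum s fun i h => hi _ (hC i h) (hC' i h), hW.cov U B hUm hUf hB hB',
      Finset.sum_congr rfl fun i h => hW.cov _ _ (hC i h) (hC' i h) hB hB', hU,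
      Set.iUnion₂_inter, measureReal_biUnion_finset, sub_self]
    · exact fun i hi j hj hij => (hd hi hj hij).mono Set.inter_subset_left Set.inter_subset_left
    · exact fun i hi => (hC i hi).inter hB
  have h0 : ∫ ω, (W U ω - ∑ i ∈ s, W (C i) ω) ^ 2 ∂P = 0 := by
    have hi : ∀ A, MeasurableSet A → volume A ≠ ⊤ →
        Integrable (fun ω => (W U ω - ∑ i ∈ s, W (C i) ω) * W A ω) P :=
      fun A hA hA' => hL.integrable_mul (hW.memLp hA hA' (p := 2) (by simp))
    have : ∀ ω, (W U ω - ∑ i ∈ s, W (C i) ω) ^ 2 = (W U ω - ∑ i ∈ s, W (C i) ω) * W U ω -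
        ∑ j ∈ s, (W U ω - ∑ i ∈ s, W (C i) ω) * W (C j) ω := fun ω => by
      rw [← Finset.mul_sum]; ring
    simp only [this]
    rw [integral_sub (hi U hUm hUf) (integrable_finsetSum s fun i h => hi _ (hC i h) (hC' i h)),
      integral_finsetSum s fun i h => hi _ (hC i h) (hC' i h), key U hUm hUf,
      Finset.sum_congr rfl fun i h => key _ (hC i h) (hC' i h)]
    simp
  rw [integral_eq_zero_iff_of_nonneg (fun ω => sq_nonneg _) hL.integrable_sq] at h0
  filter_upwards [h0] with ω hω
  exact sub_eq_zero.1 (pow_eq_zero_iff two_ne_zero |>.1 hω)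

theorem IsWhiteNoise.ae_eq_zero [IsProbabilityMeasure P] (hW : IsWhiteNoise P W) :
    W ∅ =ᵐ[P] fun _ => 0 := by
  simpa using hW.ae_eq_sum (∅ : Finset ℕ) (C := fun _ => ∅) (by simp) (by simp) (by simp)

theorem IsWhiteNoise.covariance_eq [IsProbabilityMeasure P] (hW : IsWhiteNoise P W) {A B : Set ℝ}
    (hA : MeasurableSet A) (hA' : volume A ≠ ⊤) (hB : MeasurableSet B) (hB' : volume B ≠ ⊤) :
    cov[W A, W B; P] = volume.real (A ∩ B) := by
  rw [covariance_eq_sub (hW.memLp hA hA' (by simp)) (hW.memLp hB hB' (by simp)), hW.mean A hA hA',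
    zero_mul, sub_zero]
  exact hW.cov A B hA hA' hB hB'

variable {ι : Type*} [Fintype ι] {A : ι → Set ℝ}

theorem IsWhiteNoise.hasGaussianLaw (hW : IsWhiteNoise P W)
    (hA : ∀ i, MeasurableSet (A i)) (hA' : ∀ i, volume (A i) ≠ ⊤) :
    HasGaussianLaw (fun ω i => W (A i) ω) P := by
  have h := (hW.gaussian.comp_right fun i => ⟨A i, hA i, hA' i⟩).hasGaussianLaw Finset.univ
  exact h.map_fun (ContinuousLinearMap.pi fun i : ι =>
    ContinuousLinearMap.proj (R := ℝ) (φ := fun _ : (Finset.univ : Finset ι) => ℝ)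
      ⟨i, Finset.mem_univ i⟩)

theorem IsWhiteNoise.iIndepFun [IsProbabilityMeasure P] (hW : IsWhiteNoise P W)
    (hA : ∀ i, MeasurableSet (A i)) (hA' : ∀ i, volume (A i) ≠ ⊤)
    (hd : Pairwise fun i j => Disjoint (A i) (A j)) : iIndepFun (fun i => W (A i)) P :=
  (hW.hasGaussianLaw hA hA').iIndepFun_of_covariance_eq_zero fun i j hij => by
    rw [hW.covariance_eq (hA i) (hA' i) (hA j) (hA' j), (hd hij).inter_eq]; simp

/-- Over pairwise disjoint sets, the products of values of `W` indexed by sets of indices are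
orthogonal: if `S ≠ T`, some centred independent factor occurs exactly once. -/
theorem IsWhiteNoise.integral_prod_mul_prod [IsProbabilityMeasure P] [DecidableEq ι]
    (hW : IsWhiteNoise P W)
    (hA : ∀ i, MeasurableSet (A i)) (hA' : ∀ i, volume (A i) ≠ ⊤)
    (hd : Pairwise fun i j => Disjoint (A i) (A j)) (S T : Finset ι) :
    ∫ ω, (∏ j ∈ S, W (A j) ω) * ∏ j ∈ T, W (A j) ω ∂P =
      if S = T then ∏ j ∈ S, volume.real (A j) else 0 := by
  have h1 : ∀ ω, (∏ j ∈ S, W (A j) ω) * ∏ j ∈ T, W (A j) ω =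
      ∏ j, (fun x : ℝ => (if j ∈ S then x else 1) * (if j ∈ T then x else 1)) (W (A j) ω) := by
    intro ω
    simp only [Finset.prod_mul_distrib, Finset.prod_ite_mem, Finset.univ_inter]
  rw [integral_congr_ae (Eventually.of_forall h1), (hW.iIndepFun hA hA' hd).integral_fun_prod_comp
    (f := fun j (x : ℝ) => (if j ∈ S then x else 1) * (if j ∈ T then x else 1))
    (fun i => (hW.memLp (hA i) (hA' i) (p := 2) (by simp)).aestronglyMeasurable.aemeasurable)]
  swap
  · intro i
    apply Measurable.aestronglyMeasurable
    split_ifs <;> fun_prop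
  have hm : ∀ i, ∫ ω, W (A i) ω ∂P = 0 := fun i => hW.mean _ (hA i) (hA' i)
  have hv : ∀ i, ∫ ω, W (A i) ω * W (A i) ω ∂P = volume.real (A i) := fun i => by
    rw [hW.cov _ _ (hA i) (hA' i) (hA i) (hA' i), Set.inter_self]
  split_ifs with h
  · subst h
    rw [← Finset.univ_inter S, ← Finset.prod_ite_mem]
    refine Finset.prod_congr rfl fun i _ => ?_
    by_cases hi : i ∈ S <;> simp [hi, hv]
  · obtain ⟨i, hi⟩ : ∃ i, ¬ (i ∈ S ↔ i ∈ T) := by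
      by_contra hcon
      push Not at hcon
      exact h (Finset.ext hcon)
    refine Finset.prod_eq_zero (Finset.mem_univ i) ?_
    by_cases h1 : i ∈ S <;> by_cases h2 : i ∈ T <;> simp_all

theorem IsWhiteNoise.memLp_prod [IsProbabilityMeasure P] (hW : IsWhiteNoise P W) {κ : Type*}
    (S : Finset κ) {A : κ → Set ℝ} (hA : ∀ i, MeasurableSet (A i)) (hA' : ∀ i, volume (A i) ≠ ⊤) :
    MemLp (fun ω => ∏ j ∈ S, W (A j) ω) 2 P := by
  have h := MemLp.prod' (s := S) (f := fun j => W (A j)) (μ := P) (p := fun _ => 2 * S.card)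
    fun i _ => hW.memLp (hA i) (hA' i) (ENNReal.mul_ne_top (by simp) (by simp))
  rcases S.eq_empty_or_nonempty with rfl | hS
  · simpa using memLp_const 1
  · convert h using 1
    have h0 : (S.card : ENNReal) ≠ 0 := by simpa using hS.ne_empty
    rw [Finset.sum_const, nsmul_eq_mul, ENNReal.mul_inv (Or.inr (by simp)) (Or.inr h0),
      mul_left_comm, ENNReal.mul_inv_cancel h0 (by simp), mul_one, inv_inv]

end WhiteNoise

/-! ### Boundedness of the elementary integral -/

namespace ElemKernel

variable {k : ℕ}

theorem measurable_toFun (φ : ElemKernel k) : Measurable φ.toFun := by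
  unfold toFun
  refine Finset.measurable_sum _ fun i _ => Measurable.const_mul ?_ _
  refine Finset.measurable_prod _ fun l _ => ?_
  exact (measurable_const.indicator (φ.measurableSet_A _)).comp (measurable_pi_apply l)

theorem integrable_prod_indicator {B : Fin k → Set ℝ} (hB : ∀ l, MeasurableSet (B l))
    (hB' : ∀ l, volume (B l) ≠ ⊤) :
    Integrable (fun x : Fin k → ℝ => ∏ l, (B l).indicator (fun _ => (1 : ℝ)) (x l)) :=
  Integrable.fintype_prod fun l => (integrable_indicator_iff (hB l)).2
    (integrableOn_const (hB' l))

theorem prod_indicator_mul (B C : Fin k → Set ℝ) (x : Fin k → ℝ) :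
    (∏ l, (B l).indicator (fun _ => (1 : ℝ)) (x l)) *
        ∏ l, (C l).indicator (fun _ => (1 : ℝ)) (x l) =
      ∏ l, (B l ∩ C l).indicator (fun _ => (1 : ℝ)) (x l) := by
  rw [← Finset.prod_mul_distrib]
  refine Finset.prod_congr rfl fun l _ => ?_
  by_cases h1 : x l ∈ B l <;> by_cases h2 : x l ∈ C l <;> simp [h1, h2]

/-- The boxes of an elementary kernel are disjoint, so the cross terms vanish. -/
theorem toFun_sq (φ : ElemKernel k) (x : Fin k → ℝ) :
    φ.toFun x ^ 2 = ∑ i : Fin k → Fin φ.n, φ.a i ^ 2 *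
      ∏ l, (φ.A (i l)).indicator (fun _ => (1 : ℝ)) (x l) := by
  rw [toFun, sq, Finset.sum_mul_sum]
  refine Finset.sum_congr rfl fun i _ => ?_
  rw [Finset.sum_eq_single i]
  · rw [mul_mul_mul_comm, prod_indicator_mul]
    simp [sq]
  · intro j _ hj
    obtain ⟨l, hl⟩ := Function.ne_iff.1 hj
    rw [mul_mul_mul_comm, prod_indicator_mul, Finset.prod_eq_zero (Finset.mem_univ l), mul_zero]
    rw [(φ.disjoint_A (Ne.symm hl)).inter_eq]; simp
  · simp

theorem integrable_toFun_sq (φ : ElemKernel k) : Integrable fun x => φ.toFun x ^ 2 := by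
  simp only [toFun_sq]
  exact integrable_finsetSum _ fun i _ =>
    (integrable_prod_indicator (fun l => φ.measurableSet_A _) fun l => φ.volume_A _).const_mul _

theorem memLp_toFun (φ : ElemKernel k) : MemLp φ.toFun 2 :=
  (memLp_two_iff_integrable_sq φ.measurable_toFun.aestronglyMeasurable).2 φ.integrable_toFun_sq

theorem integral_toFun_sq (φ : ElemKernel k) :
    ∫ x, φ.toFun x ^ 2 = ∑ i : Fin k → Fin φ.n, φ.a i ^ 2 * ∏ l, volume.real (φ.A (i l)) := by
  simp only [toFun_sq]
  rw [integral_finsetSum _ fun i _ =>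
    (integrable_prod_indicator (fun l => φ.measurableSet_A _) fun l => φ.volume_A _).const_mul _]
  refine Finset.sum_congr rfl fun i _ => ?_
  rw [integral_const_mul]
  congr 1
  rw [volume_pi, integral_fintype_prod_eq_prod
    (fun l y => (φ.A (i l)).indicator (fun _ => (1 : ℝ)) y)]
  refine Finset.prod_congr rfl fun l _ => ?_
  rw [integral_indicator (φ.measurableSet_A _)]
  simp

variable {Ω : Type*} [MeasurableSpace Ω] {P : Measure Ω} [IsProbabilityMeasure P]
  {W : Set ℝ → Ω → ℝ}

theorem memLp_integral (hW : IsWhiteNoise P W) (φ : ElemKernel k) : MemLp (φ.integral W) 2 P :=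
  memLp_finsetSum _ fun i _ => (hW.memLp_prod Finset.univ
    (fun l => φ.measurableSet_A (i l)) (fun l => φ.volume_A (i l))).const_mul _

/-- Grouping the multi-indices by their range. Multi-indices that are not injective carry a zero
coefficient, so each group contributes one product over distinct indices. -/
theorem integral_eq_sum_powerset (φ : ElemKernel k) (V : Fin φ.n → ℝ) :
    ∑ i : Fin k → Fin φ.n, φ.a i * ∏ l, V (i l) =
      ∑ S : Finset (Fin φ.n), (∑ i with Finset.univ.image i = S, φ.a i) * ∏ j ∈ S, V j := by
  rw [← Finset.sum_fiberwise Finset.univ (fun i : Fin k → Fin φ.n => Finset.univ.image i)]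
  refine Finset.sum_congr rfl fun S _ => ?_
  rw [Finset.sum_mul]
  refine Finset.sum_congr rfl fun i hi => ?_
  by_cases hinj : Function.Injective i
  · rw [← (Finset.mem_filter.1 hi).2, Finset.prod_image fun _ _ _ _ h => hinj h]
  · rw [φ.a_diag i hinj, zero_mul, zero_mul]

/-- The sharp constant is `k!`. The cruder `k ^ k` bounds the number of multi-indices with a given
range. -/
theorem integral_sq_integral_le (hW : IsWhiteNoise P W) (φ : ElemKernel k) :
    ∫ ω, φ.integral W ω ^ 2 ∂P ≤ (k : ℝ) ^ k * ∫ x, φ.toFun x ^ 2 := by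
  set b : Finset (Fin φ.n) → ℝ := fun S => ∑ i with Finset.univ.image i = S, φ.a i with hb
  have hI : ∀ ω, φ.integral W ω ^ 2 = ∑ S, ∑ T, b S * b T *
      ((∏ j ∈ S, W (φ.A j) ω) * ∏ j ∈ T, W (φ.A j) ω) := by
    intro ω
    rw [integral, integral_eq_sum_powerset φ (fun j => W (φ.A j) ω), sq, Finset.sum_mul_sum]
    exact Finset.sum_congr rfl fun S _ => Finset.sum_congr rfl fun T _ => mul_mul_mul_comm _ _ _ _
  have hint : ∀ S T, Integrable (fun ω => b S * b T *
      ((∏ j ∈ S, W (φ.A j) ω) * ∏ j ∈ T, W (φ.A j) ω)) P := fun S T =>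
    ((hW.memLp_prod S φ.measurableSet_A φ.volume_A).integrable_mul
      (hW.memLp_prod T φ.measurableSet_A φ.volume_A)).const_mul _
  have hE : ∫ ω, φ.integral W ω ^ 2 ∂P = ∑ S, b S ^ 2 * ∏ j ∈ S, volume.real (φ.A j) := by
    simp only [hI]
    rw [integral_finsetSum _ fun S _ => integrable_finsetSum _ fun T _ => hint S T]
    refine Finset.sum_congr rfl fun S _ => ?_
    rw [integral_finsetSum _ fun T _ => hint S T]
    simp only [integral_const_mul,
      hW.integral_prod_mul_prod φ.measurableSet_A φ.volume_A φ.disjoint_A]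
    simp [sq]
  rw [hE, integral_toFun_sq, ← Finset.sum_fiberwise Finset.univ
    (fun i : Fin k → Fin φ.n => Finset.univ.image i), Finset.mul_sum]
  refine Finset.sum_le_sum fun S _ => ?_
  have hcard : (({i | Finset.univ.image i = S} : Finset (Fin k → Fin φ.n)).card : ℝ) ≤
      (k : ℝ) ^ k := by
    rcases Finset.eq_empty_or_nonempty ({i | Finset.univ.image i = S} : Finset (Fin k → Fin φ.n))
      with h | ⟨i, hi⟩
    · rw [h]; simp
    · have hS : S.card ≤ k := by
        rw [← (Finset.mem_filter.1 hi).2]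
        simpa using Finset.card_image_le (s := Finset.univ) (f := i)
      have hsub : ({i | Finset.univ.image i = S} : Finset (Fin k → Fin φ.n)) ⊆
          Fintype.piFinset fun _ => S := by
        intro i hi
        rw [Fintype.mem_piFinset]
        intro l
        rw [← (Finset.mem_filter.1 hi).2]
        exact Finset.mem_image_of_mem i (Finset.mem_univ l)
      have h2 := Finset.card_le_card hsub
      rw [Fintype.card_piFinset_const] at h2
      exact_mod_cast h2.trans (by simpa using Nat.pow_le_pow_left hS k)
  have hprod : ∑ i with Finset.univ.image i = S, φ.a i ^ 2 * ∏ l, volume.real (φ.A (i l)) =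
      (∑ i with Finset.univ.image i = S, φ.a i ^ 2) * ∏ j ∈ S, volume.real (φ.A j) := by
    rw [Finset.sum_mul]
    refine Finset.sum_congr rfl fun i hi => ?_
    by_cases hinj : Function.Injective i
    · rw [← (Finset.mem_filter.1 hi).2,
        Finset.prod_image (f := fun j => volume.real (φ.A j)) fun _ _ _ _ h => hinj h]
    · rw [φ.a_diag i hinj]; simp
  rw [hprod, ← mul_assoc]
  refine mul_le_mul_of_nonneg_right ?_ (Finset.prod_nonneg fun _ _ => measureReal_nonneg)
  refine (sq_sum_le_card_mul_sum_sq (f := φ.a)).trans ?_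
  exact mul_le_mul_of_nonneg_right hcard (Finset.sum_nonneg fun _ _ => sq_nonneg _)

theorem eLpNorm_integral_le (hW : IsWhiteNoise P W) (φ : ElemKernel k) :
    eLpNorm (φ.integral W) 2 P ≤ ENNReal.ofReal (√((k : ℝ) ^ k)) * eLpNorm φ.toFun 2 volume := by
  have h1 := (memLp_integral hW φ).eLpNorm_eq_integral_rpow_norm (by simp) (by simp)
  have h2 := φ.memLp_toFun.eLpNorm_eq_integral_rpow_norm (by simp) (by simp)
  simp only [ENNReal.toReal_ofNat, Real.rpow_two, Real.norm_eq_abs, sq_abs, ← one_div,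
    ← Real.sqrt_eq_rpow] at h1 h2
  rw [h1, h2, ← ENNReal.ofReal_mul (by positivity), ← Real.sqrt_mul (by positivity)]
  exact ENNReal.ofReal_le_ofReal (Real.sqrt_le_sqrt (integral_sq_integral_le hW φ))

end ElemKernel

namespace ElemKernel

variable {k : ℕ}

/-! ### Refinement of elementary kernels -/

/-- The elementary kernel with sides indexed by an arbitrary finite type. -/
def ofFintype {ι : Type*} [Fintype ι] (A : ι → Set ℝ) (hA : ∀ j, MeasurableSet (A j))
    (hA' : ∀ j, volume (A j) ≠ ⊤) (hd : Pairwise fun i j => Disjoint (A i) (A j))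
    (a : (Fin k → ι) → ℝ) (ha : ∀ i, ¬ Function.Injective i → a i = 0) : ElemKernel k where
  n := Fintype.card ι
  A j := A ((Fintype.equivFin ι).symm j)
  measurableSet_A _ := hA _
  volume_A _ := hA' _
  disjoint_A _ _ hij := hd fun h => hij ((Fintype.equivFin ι).symm.injective h)
  a i := a fun l => (Fintype.equivFin ι).symm (i l)
  a_diag _ hi := ha _ fun h => hi fun _ _ hl => h (congrArg _ hl)

theorem sum_ofFintype {ι : Type*} [Fintype ι] (a : (Fin k → ι) → ℝ) (V : Fin k → ι → ℝ) :
    ∑ i : Fin k → Fin (Fintype.card ι), a (fun l => (Fintype.equivFin ι).symm (i l)) *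
      ∏ l, V l ((Fintype.equivFin ι).symm (i l)) = ∑ i : Fin k → ι, a i * ∏ l, V l (i l) :=
  Fintype.sum_equiv (Equiv.piCongrRight fun _ => (Fintype.equivFin ι).symm) _ _ fun _ => rfl

theorem toFun_ofFintype {ι : Type*} [Fintype ι] (A : ι → Set ℝ) (hA : ∀ j, MeasurableSet (A j))
    (hA' : ∀ j, volume (A j) ≠ ⊤) (hd : Pairwise fun i j => Disjoint (A i) (A j))
    (a : (Fin k → ι) → ℝ) (ha : ∀ i, ¬ Function.Injective i → a i = 0) (x : Fin k → ℝ) :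
    (ofFintype A hA hA' hd a ha).toFun x =
      ∑ i : Fin k → ι, a i * ∏ l, (A (i l)).indicator (fun _ => (1 : ℝ)) (x l) :=
  sum_ofFintype a fun l j => (A j).indicator (fun _ => (1 : ℝ)) (x l)

theorem integral_ofFintype {ι : Type*} [Fintype ι] (A : ι → Set ℝ) (hA : ∀ j, MeasurableSet (A j))
    (hA' : ∀ j, volume (A j) ≠ ⊤) (hd : Pairwise fun i j => Disjoint (A i) (A j))
    (a : (Fin k → ι) → ℝ) (ha : ∀ i, ¬ Function.Injective i → a i = 0) {Ω : Type*}
    (W : Set ℝ → Ω → ℝ) (ω : Ω) :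
    (ofFintype A hA hA' hd a ha).integral W ω =
      ∑ i : Fin k → ι, a i * ∏ l, W (A (i l)) ω :=
  sum_ofFintype a fun _ j => W (A j) ω

/-- The nonempty atoms of the algebra of sets generated by a family `D`: the points that belong to
`D q` exactly for `q ∈ s`. The points outside every `D q` are discarded, so that atoms have finite
measure when the `D q` do. -/
def atom {κ : Type*} (D : κ → Set ℝ) (s : Finset κ) : Set ℝ :=
  {x | s.Nonempty ∧ ∀ q, x ∈ D q ↔ q ∈ s}

section Atom

variable {κ : Type*} {D : κ → Set ℝ}

theorem atom_subset {q : κ} {s : Finset κ} (hq : q ∈ s) : atom D s ⊆ D q :=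
  fun _ hx => (hx.2 q).2 hq

theorem measurableSet_atom [Finite κ] (hD : ∀ q, MeasurableSet (D q)) (s : Finset κ) :
    MeasurableSet (atom D s) := by
  rw [atom, Set.ofPred_and, Set.ofPred_forall]
  refine (MeasurableSet.const _).inter (MeasurableSet.iInter fun q => ?_)
  by_cases hq : q ∈ s
  · simpa [hq] using hD q
  · simp only [hq, iff_false]
    exact (hD q).compl

theorem volume_atom (hD : ∀ q, volume (D q) ≠ ⊤) (s : Finset κ) : volume (atom D s) ≠ ⊤ := by
  rcases s.eq_empty_or_nonempty with rfl | ⟨q, hq⟩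
  · simp [atom]
  · exact measure_ne_top_of_subset (atom_subset hq) (hD q)

theorem pairwise_disjoint_atom (D : κ → Set ℝ) :
    Pairwise fun s t => Disjoint (atom D s) (atom D t) := by
  intro s t h
  rw [Set.disjoint_left]
  intro x hs ht
  exact h (Finset.ext fun q => (hs.2 q).symm.trans (ht.2 q))

theorem biUnion_atom [Fintype κ] [DecidableEq κ] (q : κ) :
    ⋃ s ∈ ({s | q ∈ s} : Finset (Finset κ)), atom D s = D q := by
  classical
  ext x
  simp only [Finset.mem_filter, Finset.mem_univ, true_and, Set.mem_iUnion, exists_prop]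
  constructor
  · rintro ⟨s, hs, hx⟩
    exact atom_subset hs hx
  · intro hx
    exact ⟨Finset.univ.filter fun q => x ∈ D q, by simpa using hx, ⟨q, by simpa using hx⟩, by simp⟩

end Atom

section Refinement

variable {J : Type*} [Fintype J] [DecidableEq J]

/-- The coefficients, with respect to the atoms of all the sides, of a linear combination with
coefficients `b` of products indexed by `J`. They are set to zero on the diagonals. -/
def atomCoeff (b : J → ℝ) (s : Fin k → Finset (J × Fin k)) : ℝ := by
  classical
  exact if Function.Injective s then ∑ j with (∀ l, (j, l) ∈ s l), b j else 0

/-- Expanding products of sums over atoms. The hypothesis on `D` says that the boxes are off the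
diagonals, so that the coefficients discarded by `atomCoeff` multiply an empty atom. -/
theorem sum_prod_eq_sum_atomCoeff (b : J → ℝ) (D : J × Fin k → Set ℝ)
    (hD : ∀ j, b j ≠ 0 → Pairwise fun l m => Disjoint (D (j, l)) (D (j, m)))
    (V : Fin k → Set ℝ → ℝ) (hV0 : ∀ l, V l ∅ = 0)
    (hV : ∀ l q, V l (D q) = ∑ s with q ∈ s, V l (atom D s)) :
    ∑ j, b j * ∏ l, V l (D (j, l)) =
      ∑ s : Fin k → Finset (J × Fin k), atomCoeff b s * ∏ l, V l (atom D (s l)) := by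
  classical
  have h1 : ∀ j, ∏ l, V l (D (j, l)) =
      ∑ s : Fin k → Finset (J × Fin k),
        if ∀ l, (j, l) ∈ s l then ∏ l, V l (atom D (s l)) else 0 := by
    intro j
    simp only [hV, Finset.sum_filter]
    rw [Finset.prod_univ_sum]
    simp only [Fintype.piFinset_univ]
    refine Finset.sum_congr rfl fun s _ => ?_
    split_ifs with h
    · exact Finset.prod_congr rfl fun l _ => if_pos (h l)
    · push Not at h
      obtain ⟨l, hl⟩ := h
      exact Finset.prod_eq_zero (Finset.mem_univ l) (if_neg hl)
  simp only [h1, Finset.mul_sum]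
  rw [Finset.sum_comm]
  refine Finset.sum_congr rfl fun s _ => ?_
  have h2 : ∑ j, b j * (if ∀ l, (j, l) ∈ s l then ∏ l, V l (atom D (s l)) else 0) =
      (∑ j with (∀ l, (j, l) ∈ s l), b j) * ∏ l, V l (atom D (s l)) := by
    rw [Finset.sum_mul, Finset.sum_filter]
    refine Finset.sum_congr rfl fun j _ => ?_
    split_ifs <;> simp
  rw [h2]
  unfold atomCoeff
  split_ifs with hs
  · rfl
  rw [zero_mul]
  obtain ⟨l, m, hlm, hne⟩ : ∃ l m, s l = s m ∧ l ≠ m := by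
    simpa [Function.Injective] using hs
  by_cases hne0 : ∃ j, (∀ l, (j, l) ∈ s l) ∧ b j ≠ 0
  -- A repeated atom lies in two sides of a box off the diagonals, so it is empty.
  · obtain ⟨j, hj, hbj⟩ := hne0
    have he : atom D (s l) = ∅ := by
      rw [Set.eq_empty_iff_forall_notMem]
      intro x hx
      exact Set.disjoint_left.1 (hD j hbj hne) (atom_subset (hj l) hx)
        (atom_subset (hlm ▸ hj m) hx)
    rw [Finset.prod_eq_zero (Finset.mem_univ l) (by rw [he, hV0]), mul_zero]
  · push Not at hne0
    rw [Finset.sum_eq_zero fun j hj => hne0 j (Finset.mem_filter.1 hj).2, zero_mul]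

/-- A linear combination of indicators of boxes lying off the diagonals is given by an elementary
kernel, and the elementary integral does not depend on the representation. -/
theorem exists_eq_sum (b : J → ℝ) (D : J × Fin k → Set ℝ) (hm : ∀ q, MeasurableSet (D q))
    (hf : ∀ q, volume (D q) ≠ ⊤)
    (hD : ∀ j, b j ≠ 0 → Pairwise fun l m => Disjoint (D (j, l)) (D (j, m)))
    {Ω : Type*} [MeasurableSpace Ω] {P : Measure Ω} [IsProbabilityMeasure P]
    {W : Set ℝ → Ω → ℝ} (hW : IsWhiteNoise P W) :
    ∃ χ : ElemKernel k,
      (∀ x, χ.toFun x = ∑ j, b j * ∏ l, (D (j, l)).indicator (fun _ => (1 : ℝ)) (x l)) ∧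
      χ.integral W =ᵐ[P] fun ω => ∑ j, b j * ∏ l, W (D (j, l)) ω := by
  classical
  refine ⟨ofFintype (atom D) (measurableSet_atom hm) (volume_atom hf)
    (pairwise_disjoint_atom D) (atomCoeff b) (fun s hs => by simp [atomCoeff, hs]),
    fun x => ?_, ?_⟩
  · rw [toFun_ofFintype]
    refine (sum_prod_eq_sum_atomCoeff b D hD
      (fun l A => A.indicator (fun _ => (1 : ℝ)) (x l)) (by simp) fun l q => ?_).symm
    conv_lhs => rw [← biUnion_atom (D := D) q]
    rw [Finset.indicator_biUnion_apply]
    exact fun s _ t _ h => pairwise_disjoint_atom D h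
  · have hadd : ∀ᵐ ω ∂P, ∀ q, W (D q) ω = ∑ s with q ∈ s, W (atom D s) ω := by
      rw [ae_all_iff]
      intro q
      have := hW.ae_eq_sum ({s | q ∈ s} : Finset (Finset (J × Fin k))) (C := atom D)
        (fun s _ => measurableSet_atom hm s) (fun s _ => volume_atom hf s)
        (fun s _ t _ h => pairwise_disjoint_atom D h)
      rwa [biUnion_atom] at this
    filter_upwards [hadd, hW.ae_eq_zero] with ω h1 h0
    rw [integral_ofFintype]
    exact (sum_prod_eq_sum_atomCoeff b D hD (fun _ A => W A ω) (fun _ => h0)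
      fun _ q => h1 q).symm

end Refinement

/-- The difference of two elementary kernels is an elementary kernel: refine the sides of both. -/
theorem exists_eq_sub (φ ψ : ElemKernel k)
    {Ω : Type*} [MeasurableSpace Ω] {P : Measure Ω} [IsProbabilityMeasure P]
    {W : Set ℝ → Ω → ℝ} (hW : IsWhiteNoise P W) :
    ∃ χ : ElemKernel k, (∀ x, χ.toFun x = φ.toFun x - ψ.toFun x) ∧
      χ.integral W =ᵐ[P] fun ω => φ.integral W ω - ψ.integral W ω := by
  let J := (Fin k → Fin φ.n) ⊕ (Fin k → Fin ψ.n)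
  let b : J → ℝ := Sum.elim φ.a fun i => -ψ.a i
  let D : J × Fin k → Set ℝ := fun q => Sum.elim (fun i => φ.A (i q.2)) (fun i => ψ.A (i q.2)) q.1
  have hoff : ∀ (θ : ElemKernel k) (i : Fin k → Fin θ.n), θ.a i ≠ 0 →
      Pairwise fun l m => Disjoint (θ.A (i l)) (θ.A (i m)) := fun θ i hi l m hlm =>
    θ.disjoint_A fun h => hlm (not_not.1 (mt (θ.a_diag i) hi) h)
  obtain ⟨χ, h1, h2⟩ := exists_eq_sum b D
    (by rintro ⟨i | i, l⟩ <;> simp [D, measurableSet_A])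
    (by rintro ⟨i | i, l⟩ <;> simp [D, volume_A])
    (by
      rintro (i | i) hi
      · exact hoff φ i hi
      · exact hoff ψ i (neg_ne_zero.1 hi)) hW
  refine ⟨χ, fun x => ?_, h2.trans (Eventually.of_forall fun ω => ?_)⟩
  · rw [h1]
    simp [b, D, J, Fintype.sum_sum_type, toFun, sub_eq_add_neg]
  · simp [b, D, J, Fintype.sum_sum_type, integral, sub_eq_add_neg]

theorem eLpNorm_integral_sub_le {Ω : Type*} [MeasurableSpace Ω] {P : Measure Ω}
    [IsProbabilityMeasure P] {W : Set ℝ → Ω → ℝ} (hW : IsWhiteNoise P W) (φ ψ : ElemKernel k) :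
    eLpNorm (fun ω => φ.integral W ω - ψ.integral W ω) 2 P ≤
      ENNReal.ofReal (√((k : ℝ) ^ k)) * eLpNorm (fun x => φ.toFun x - ψ.toFun x) 2 volume := by
  obtain ⟨χ, h1, h2⟩ := exists_eq_sub φ ψ hW
  rw [← eLpNorm_congr_ae h2, ← funext h1]
  exact eLpNorm_integral_le hW χ

end ElemKernel

/-! ### Density of elementary kernels -/

variable {k : ℕ}

theorem ae_injective : ∀ᵐ x : Fin k → ℝ, Function.Injective x := by
  have h : ∀ l m : Fin k, l ≠ m → ∀ᵐ x : Fin k → ℝ, x l ≠ x m := by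
    intro l m hlm
    let s : Submodule ℝ (Fin k → ℝ) := LinearMap.ker
      (LinearMap.proj (R := ℝ) (φ := fun _ : Fin k => ℝ) l - LinearMap.proj m)
    have hs : s ≠ ⊤ := by
      intro h
      have : Pi.single l (1 : ℝ) ∈ s := h ▸ Submodule.mem_top
      simp [s, LinearMap.mem_ker, Pi.single_eq_of_ne (Ne.symm hlm)] at this
    have h0 := Measure.addHaar_submodule (volume : Measure (Fin k → ℝ)) s hs
    rw [ae_iff]
    convert h0 using 2
    ext x
    simp [s, LinearMap.mem_ker, sub_eq_zero]
  have h' : ∀ᵐ x : Fin k → ℝ, ∀ l m : Fin k, l ≠ m → x l ≠ x m := by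
    simp only [ae_all_iff]
    exact h
  filter_upwards [h'] with x hx l m hlm
  by_contra hne
  exact hx l m hne hlm

theorem abs_floor_mul_div_sub_le (m : ℕ) (y : ℝ) :
    |(⌊((m : ℝ) + 1) * y⌋ : ℝ) / (m + 1) - y| ≤ 1 / (m + 1) := by
  have hm : (0 : ℝ) < m + 1 := by positivity
  have h1 := Int.floor_le (((m : ℝ) + 1) * y)
  have h2 := Int.lt_floor_add_one (((m : ℝ) + 1) * y)
  rw [show (⌊((m : ℝ) + 1) * y⌋ : ℝ) / (m + 1) - y =
    (⌊((m : ℝ) + 1) * y⌋ - ((m : ℝ) + 1) * y) / (m + 1) by field_simp, abs_div, abs_of_pos hm]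
  exact div_le_div_of_nonneg_right (by rw [abs_le]; constructor <;> linarith) hm.le

namespace ElemKernel

/-- A compactly supported function is sampled on the grid of mesh `1 / (m + 1)`, the boxes that meet
a diagonal being left out. -/
theorem exists_eq_sample {f : (Fin k → ℝ) → ℝ} {R : ℕ} (hR : ∀ x, f x ≠ 0 → ‖x‖ < R) (m : ℕ) :
    ∃ φ : ElemKernel k, ∀ x, φ.toFun x =
      if Function.Injective (fun l => ⌊((m : ℝ) + 1) * x l⌋) then
        f (fun l => (⌊((m : ℝ) + 1) * x l⌋ : ℝ) / (m + 1)) else 0 := by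
  classical
  have hm : (0 : ℝ) < m + 1 := by positivity
  let ι := Finset.Ico (-(R * (m + 1) : ℤ)) (R * (m + 1))
  let A : ι → Set ℝ := fun z => {y | ⌊((m : ℝ) + 1) * y⌋ = (z : ℤ)}
  have hAeq : ∀ z, A z = Set.Ico (((z : ℤ) : ℝ) / (m + 1)) ((((z : ℤ) : ℝ) + 1) / (m + 1)) := by
    intro z
    ext y
    simp only [A, Set.mem_ofPred_eq, Int.floor_eq_iff, Set.mem_Ico, div_le_iff₀' hm,
      lt_div_iff₀' hm]
  have hAd : Pairwise fun z w => Disjoint (A z) (A w) := fun z w hzw =>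
    Set.disjoint_left.2 fun y h1 h2 => hzw (Subtype.ext (h1.symm.trans h2))
  refine ⟨ofFintype A (fun z => by rw [hAeq]; exact measurableSet_Ico)
    (fun z => by rw [hAeq]; exact measure_Ico_lt_top.ne)
    hAd
    (fun i => if Function.Injective i then f (fun l => (((i l : ℤ) : ℝ) / (m + 1))) else 0)
    (fun i hi => if_neg hi), fun x => ?_⟩
  rw [toFun_ofFintype]
  by_cases hx : ∀ l, ⌊((m : ℝ) + 1) * x l⌋ ∈ ι
  · let i₀ : Fin k → ι := fun l => ⟨_, hx l⟩
    have hinj : Function.Injective i₀ ↔ Function.Injective fun l => ⌊((m : ℝ) + 1) * x l⌋ :=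
      ⟨fun h a b hab => h (Subtype.ext hab), fun h a b hab => h (congrArg Subtype.val hab)⟩
    rw [Finset.sum_eq_single i₀]
    · simp only [hinj]
      rw [Finset.prod_eq_one, mul_one]
      intro l _
      exact Set.indicator_of_mem (show x l ∈ A (i₀ l) from rfl) _
    · intro i _ hi
      obtain ⟨l, hl⟩ := Function.ne_iff.1 hi
      rw [Finset.prod_eq_zero (Finset.mem_univ l), mul_zero]
      have hnot : x l ∉ A (i l) := fun h => hl (Subtype.ext (Eq.symm h))
      exact Set.indicator_of_notMem hnot _
    · simp
  -- Off the indexed cells both sides vanish, since the sample point has norm at least `R`.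
  · push Not at hx
    obtain ⟨l, hl⟩ := hx
    have hz : f (fun l => (⌊((m : ℝ) + 1) * x l⌋ : ℝ) / (m + 1)) = 0 := by
      by_contra hne
      have h1 := (norm_le_pi_norm _ l).trans_lt (hR _ hne)
      rw [Real.norm_eq_abs, abs_lt, lt_div_iff₀ hm, div_lt_iff₀ hm] at h1
      refine hl (Finset.mem_Ico.2 ⟨?_, ?_⟩)
      · have := h1.1.le
        rw [neg_mul] at this
        exact_mod_cast this
      · exact_mod_cast h1.2
    rw [hz, ite_self]
    refine Finset.sum_eq_zero fun i _ => ?_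
    rw [Finset.prod_eq_zero (Finset.mem_univ l), mul_zero]
    have hnot : x l ∉ A (i l) := fun h => by
      have h' : ⌊((m : ℝ) + 1) * x l⌋ = ((i l : ι) : ℤ) := h
      exact hl (h' ▸ (i l).2)
    exact Set.indicator_of_notMem hnot _

/-- The samples on finer and finer grids converge at every point off the diagonals, which are null,
and are dominated by a constant on a fixed ball. -/
theorem exists_tendsto_of_hasCompactSupport {f : (Fin k → ℝ) → ℝ} (hf : Continuous f)
    (hf' : HasCompactSupport f) :
    ∃ φ : ℕ → ElemKernel k,
      Tendsto (fun m => eLpNorm (fun x => (φ m).toFun x - f x) 2 volume) atTop (𝓝 0) := by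
  classical
  obtain ⟨R, hR⟩ : ∃ R : ℕ, ∀ x, f x ≠ 0 → ‖x‖ < R := by
    obtain ⟨r, hr⟩ := hf'.isCompact.isBounded.exists_norm_le
    obtain ⟨R, hR⟩ := exists_nat_gt r
    exact ⟨R, fun x hx => (hr x (subset_tsupport f hx)).trans_lt hR⟩
  obtain ⟨C, hC⟩ := hf'.exists_bound_of_continuous hf
  have hC0 : 0 ≤ C := (norm_nonneg _).trans (hC 0)
  choose φ hφ using exists_eq_sample hR
  refine ⟨φ, ?_⟩
  set G : ℕ → (Fin k → ℝ) → Fin k → ℝ := fun m x l => (⌊((m : ℝ) + 1) * x l⌋ : ℝ) / (m + 1) with hG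
  have hGd : ∀ m x, ‖G m x - x‖ ≤ 1 / (m + 1) := fun m x =>
    (pi_norm_le_iff_of_nonneg (by positivity)).2 fun l => abs_floor_mul_div_sub_le m (x l)
  have hGt : ∀ x, Tendsto (fun m => G m x) atTop (𝓝 x) := fun x =>
    tendsto_iff_norm_sub_tendsto_zero.2 (squeeze_zero (fun _ => norm_nonneg _) (fun m => hGd m x)
      tendsto_one_div_add_atTop_nhds_zero_nat)
  have hbound : ∀ m x, ‖(φ m).toFun x - f x‖ₑ ^ (2 : ℝ) ≤
      (Metric.closedBall (0 : Fin k → ℝ) (R + 1)).indicator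
        (fun _ => ENNReal.ofReal (C + C) ^ (2 : ℝ)) x := by
    intro m x
    by_cases hx : x ∈ Metric.closedBall (0 : Fin k → ℝ) (R + 1)
    · rw [Set.indicator_of_mem hx, ← ofReal_norm]
      gcongr
      refine (norm_sub_le _ _).trans (add_le_add ?_ (hC x))
      rw [hφ]
      split_ifs
      · exact hC _
      · simpa using hC0
    · rw [Set.indicator_of_notMem hx]
      rw [mem_closedBall_zero_iff, not_le] at hx
      have h1 : f x = 0 := by
        by_contra h
        linarith [hR x h]
      have h2 : f (G m x) = 0 := by
        by_contra h
        have h3 := hR _ h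
        have h4 : ‖x‖ ≤ ‖G m x‖ + ‖G m x - x‖ := by
          simpa using norm_sub_le (G m x) (G m x - x)
        have h5 : (1 : ℝ) / (m + 1) ≤ 1 := by
          rw [div_le_one (by positivity)]; linarith [(Nat.cast_nonneg m : (0 : ℝ) ≤ m)]
        linarith [hGd m x]
      have h3 : (φ m).toFun x = 0 := by
        rw [hφ]
        split_ifs
        · exact h2
        · rfl
      simp [h1, h3]
  have hlim : Tendsto (fun m => ∫⁻ x, ‖(φ m).toFun x - f x‖ₑ ^ (2 : ℝ)) atTop (𝓝 0) := by
    rw [← lintegral_zero (α := Fin k → ℝ) (μ := volume)]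
    refine tendsto_lintegral_of_dominated_convergence _
      (fun m => (((φ m).measurable_toFun.sub hf.measurable).enorm.pow_const _))
      (fun m => Eventually.of_forall (hbound m)) ?_ ?_
    · rw [lintegral_indicator Metric.isClosed_closedBall.measurableSet, setLIntegral_const]
      exact ENNReal.mul_ne_top (by simp) measure_closedBall_lt_top.ne
    · filter_upwards [ae_injective] with x hx
      -- The grid corners converge to `x`, so their coordinates are eventually distinct.
      have hev : ∀ᶠ m : ℕ in atTop, Function.Injective fun l => ⌊((m : ℝ) + 1) * x l⌋ := by
        have h1 : ∀ l l', ∀ᶠ m : ℕ in atTop, l ≠ l' → G m x l ≠ G m x l' := by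
          intro l l'
          by_cases hll : l = l'
          · simp [hll]
          · filter_upwards [((tendsto_pi_nhds.1 (hGt x) l).sub
              (tendsto_pi_nhds.1 (hGt x) l')).eventually_ne (sub_ne_zero.2 (hx.ne hll))] with m hm _
            exact sub_ne_zero.1 hm
        filter_upwards [eventually_all.2 fun l => eventually_all.2 fun l' => h1 l l']
          with m hm l l' h
        by_contra hne
        refine hm l l' hne ?_
        simp only [hG]
        rw [show ⌊((m : ℝ) + 1) * x l⌋ = ⌊((m : ℝ) + 1) * x l'⌋ from h]
      have h2 : Tendsto (fun m => (φ m).toFun x - f x) atTop (𝓝 0) := by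
        rw [← sub_self (f x)]
        refine Tendsto.sub ?_ tendsto_const_nhds
        refine ((hf.tendsto x).comp (hGt x)).congr' ?_
        filter_upwards [hev] with m hm
        rw [hφ, if_pos hm]
        rfl
      have h3 := (h2.enorm).ennrpow_const (2 : ℝ)
      simpa using h3
  have hpow := hlim.ennrpow_const (1 / 2 : ℝ)
  simp only [eLpNorm_eq_lintegral_rpow_enorm_toReal two_ne_zero ENNReal.ofNat_ne_top,
    ENNReal.toReal_ofNat]
  simpa using hpow

/-- Elementary kernels vanishing on the diagonals are dense in `L²(ℝ^k)`. -/
theorem exists_tendsto {f : (Fin k → ℝ) → ℝ} (hf : MemLp f 2 volume) :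
    ∃ φ : ℕ → ElemKernel k,
      Tendsto (fun m => eLpNorm (fun x => (φ m).toFun x - f x) 2 volume) atTop (𝓝 0) := by
  have key : ∀ m : ℕ, ∃ φ : ElemKernel k,
      eLpNorm (fun x => φ.toFun x - f x) 2 volume ≤ (m : ENNReal)⁻¹ + (m : ENNReal)⁻¹ := by
    intro m
    have hm : (m : ENNReal)⁻¹ ≠ 0 := ENNReal.inv_ne_zero.2 (ENNReal.natCast_ne_top m)
    obtain ⟨g, hg1, hg2, hg3, hg4⟩ := hf.exists_hasCompactSupport_eLpNorm_sub_le (by simp) hm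
    obtain ⟨φ, hφ⟩ := exists_tendsto_of_hasCompactSupport hg3 hg1
    obtain ⟨n, hn⟩ := (hφ.eventually_le_const (pos_iff_ne_zero.2 hm)).exists
    refine ⟨φ n, ?_⟩
    have h1 : (fun x => (φ n).toFun x - f x) = (fun x => (φ n).toFun x - g x) - (f - g) := by
      ext x; simp
    rw [h1]
    exact (eLpNorm_sub_le ((φ n).measurable_toFun.aestronglyMeasurable.sub hg4.1) (hf.1.sub hg4.1)
      (by simp)).trans (add_le_add hn hg2)
  choose φ hφ using key
  refine ⟨φ, tendsto_of_tendsto_of_tendsto_of_le_of_le tendsto_const_nhds ?_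
    (fun _ => zero_le) hφ⟩
  simpa using ENNReal.tendsto_inv_nat_nhds_zero.add ENNReal.tendsto_inv_nat_nhds_zero

end ElemKernel

/-! ### The Wiener-Itô integral of a square integrable kernel -/

section WienerIntegral

variable {k : ℕ} {Ω : Type*} [MeasurableSpace Ω] {P : Measure Ω}
  {W : Set ℝ → Ω → ℝ} {f f' : (Fin k → ℝ) → ℝ} {Y Y' : Ω → ℝ}

theorem tendsto_eLpNorm_of_le {α : Type*} [MeasurableSpace α] {μ : Measure α}
    {u u₁ u₂ : ℕ → α → ℝ} (hu₁ : ∀ m, AEStronglyMeasurable (u₁ m) μ)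
    (hu₂ : ∀ m, AEStronglyMeasurable (u₂ m) μ) (h : ∀ m x, u m x = u₁ m x + u₂ m x)
    (h₁ : Tendsto (fun m => eLpNorm (u₁ m) 2 μ) atTop (𝓝 0))
    (h₂ : Tendsto (fun m => eLpNorm (u₂ m) 2 μ) atTop (𝓝 0)) :
    Tendsto (fun m => eLpNorm (u m) 2 μ) atTop (𝓝 0) := by
  have h3 := h₁.add h₂
  rw [add_zero] at h3
  refine tendsto_of_tendsto_of_tendsto_of_le_of_le tendsto_const_nhds h3 (fun _ => zero_le)
    fun m => ?_
  rw [show u m = u₁ m + u₂ m from funext (h m)]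
  exact eLpNorm_add_le (hu₁ m) (hu₂ m) (by simp)

theorem tendsto_eLpNorm_const_mul {α : Type*} [MeasurableSpace α] {μ : Measure α}
    {u : ℕ → α → ℝ} (c : ℝ) (h : Tendsto (fun m => eLpNorm (u m) 2 μ) atTop (𝓝 0)) :
    Tendsto (fun m => eLpNorm (fun x => c * u m x) 2 μ) atTop (𝓝 0) := by
  have h1 : ∀ m, eLpNorm (fun x => c * u m x) 2 μ = ‖c‖ₑ * eLpNorm (u m) 2 μ := fun m =>
    eLpNorm_const_smul c (u m) 2 μ
  have h2 := ENNReal.Tendsto.const_mul h (Or.inr (enorm_ne_top (x := c)))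
  rw [mul_zero] at h2
  simpa only [h1] using h2

theorem eLpNorm_integral_sub_integral_le [IsProbabilityMeasure P] (hW : IsWhiteNoise P W)
    (hf : AEStronglyMeasurable f volume) (φ ψ : ElemKernel k) :
    eLpNorm (fun ω => φ.integral W ω - ψ.integral W ω) 2 P ≤ ENNReal.ofReal (√((k : ℝ) ^ k)) *
      (eLpNorm (fun x => φ.toFun x - f x) 2 volume +
        eLpNorm (fun x => ψ.toFun x - f x) 2 volume) := by
  refine (ElemKernel.eLpNorm_integral_sub_le hW φ ψ).trans ?_
  gcongr
  have h : (fun x => φ.toFun x - ψ.toFun x) =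
      (fun x => φ.toFun x - f x) - (fun x => ψ.toFun x - f x) := by
    ext x; simp
  rw [h]
  exact eLpNorm_sub_le (φ.measurable_toFun.aestronglyMeasurable.sub hf)
    (ψ.measurable_toFun.aestronglyMeasurable.sub hf) (by simp)

/-- The Wiener-Itô integral may be computed along any approximating sequence of elementary kernels,
not only the one provided by its definition. -/
theorem IsWienerIntegral.tendsto [IsProbabilityMeasure P] (hW : IsWhiteNoise P W)
    (h : IsWienerIntegral P W f Y) {φ : ℕ → ElemKernel k}
    (hφ : Tendsto (fun m => eLpNorm (fun x => (φ m).toFun x - f x) 2 volume) atTop (𝓝 0)) :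
    Tendsto (fun m => eLpNorm (fun ω => (φ m).integral W ω - Y ω) 2 P) atTop (𝓝 0) := by
  obtain ⟨hf, hY, ψ, hψ, hψ'⟩ := h
  have h1 : Tendsto (fun m => eLpNorm (fun ω => (φ m).integral W ω - (ψ m).integral W ω) 2 P)
      atTop (𝓝 0) := by
    refine tendsto_of_tendsto_of_tendsto_of_le_of_le tendsto_const_nhds ?_ (fun _ => zero_le)
      fun m => eLpNorm_integral_sub_integral_le hW hf.1 (φ m) (ψ m)
    simpa using ENNReal.Tendsto.const_mul (hφ.add hψ) (Or.inr ENNReal.ofReal_ne_top)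
  refine tendsto_eLpNorm_of_le
    (fun m => ((ElemKernel.memLp_integral hW (φ m)).sub (ElemKernel.memLp_integral hW (ψ m))).1)
    (fun m => ((ElemKernel.memLp_integral hW (ψ m)).sub hY).1) (fun m ω => ?_) h1 hψ'
  simp

theorem exists_isWienerIntegral [IsProbabilityMeasure P] (hW : IsWhiteNoise P W)
    (hf : MemLp f 2 volume) :
    ∃ Y, IsWienerIntegral P W f Y := by
  obtain ⟨φ, hφ⟩ := ElemKernel.exists_tendsto hf
  have hI := fun m => ElemKernel.memLp_integral hW (φ m)
  have hc : CauchySeq fun m => (hI m).toLp := by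
    rw [Lp.cauchySeq_Lp_iff_cauchySeq_eLpNorm]
    have hb : ∀ n : ℕ × ℕ, eLpNorm (⇑((hI n.1).toLp) - ⇑((hI n.2).toLp)) 2 P ≤
        ENNReal.ofReal (√((k : ℝ) ^ k)) *
          (eLpNorm (fun x => (φ n.1).toFun x - f x) 2 volume +
            eLpNorm (fun x => (φ n.2).toFun x - f x) 2 volume) := fun n => by
      rw [eLpNorm_congr_ae ((hI n.1).coeFn_toLp.sub (hI n.2).coeFn_toLp)]
      exact eLpNorm_integral_sub_integral_le hW hf.1 _ _
    refine tendsto_of_tendsto_of_tendsto_of_le_of_le tendsto_const_nhds ?_ (fun _ => zero_le) hb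
    rw [← prod_atTop_atTop_eq]
    simpa using ENNReal.Tendsto.const_mul ((hφ.comp tendsto_fst).add (hφ.comp tendsto_snd))
      (Or.inr ENNReal.ofReal_ne_top)
  obtain ⟨Y, hY⟩ := cauchySeq_tendsto_of_complete hc
  refine ⟨Y, hf, Lp.memLp Y, φ, hφ, ?_⟩
  rw [← Lp.toLp_coeFn Y (Lp.memLp Y), Lp.tendsto_Lp_iff_tendsto_eLpNorm''] at hY
  exact hY

/-- The Wiener-Itô integral depends on the kernel only up to null sets. -/
theorem IsWienerIntegral.congr_ae (h : IsWienerIntegral P W f Y) (hff' : f =ᵐ[volume] f') :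
    IsWienerIntegral P W f' Y := by
  obtain ⟨hf, hY, φ, h1, h2⟩ := h
  refine ⟨hf.ae_eq hff', hY, φ, h1.congr fun m => eLpNorm_congr_ae ?_, h2⟩
  filter_upwards [hff'] with x hx
  rw [hx]

theorem IsWienerIntegral.sub [IsProbabilityMeasure P] (hW : IsWhiteNoise P W)
    (h : IsWienerIntegral P W f Y) (h' : IsWienerIntegral P W f' Y') :
    IsWienerIntegral P W (fun x => f x - f' x) (fun ω => Y ω - Y' ω) := by
  obtain ⟨hf, hY, φ, h1, h2⟩ := h
  obtain ⟨hf', hY', φ', h1', h2'⟩ := h'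
  choose χ hχ hχ' using fun m => ElemKernel.exists_eq_sub (φ m) (φ' m) hW
  refine ⟨hf.sub hf', hY.sub hY', χ, ?_, ?_⟩
  · refine tendsto_eLpNorm_of_le (u₁ := fun m x => (φ m).toFun x - f x)
      (u₂ := fun m x => f' x - (φ' m).toFun x)
      (fun m => (φ m).measurable_toFun.aestronglyMeasurable.sub hf.1)
      (fun m => hf'.1.sub (φ' m).measurable_toFun.aestronglyMeasurable) (fun m x => ?_) h1
      (h1'.congr fun m => ?_)
    · rw [hχ]; ring
    · exact eLpNorm_sub_comm (φ' m).toFun f' 2 volume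
  · have h3 := tendsto_eLpNorm_of_le
      (u := fun m ω => ((φ m).integral W ω - (φ' m).integral W ω) - (Y ω - Y' ω))
      (u₁ := fun m ω => (φ m).integral W ω - Y ω)
      (u₂ := fun m ω => Y' ω - (φ' m).integral W ω)
      (fun m => (ElemKernel.memLp_integral hW (φ m)).1.sub hY.1)
      (fun m => hY'.1.sub (ElemKernel.memLp_integral hW (φ' m)).1) (fun m ω => by ring) h2
      (h2'.congr fun m => eLpNorm_sub_comm ((φ' m).integral W) Y' 2 P)
    refine h3.congr fun m => eLpNorm_congr_ae ?_
    filter_upwards [hχ' m] with ω hω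
    rw [hω]

/-- The elementary kernel `c • φ`. -/
def ElemKernel.smul (c : ℝ) (φ : ElemKernel k) : ElemKernel k where
  __ := φ
  a i := c * φ.a i
  a_diag i hi := by rw [φ.a_diag i hi, mul_zero]

theorem ElemKernel.toFun_smul (c : ℝ) (φ : ElemKernel k) (x : Fin k → ℝ) :
    (φ.smul c).toFun x = c * φ.toFun x := by
  rw [toFun, toFun, Finset.mul_sum]
  exact Finset.sum_congr rfl fun i _ => mul_assoc _ _ _

theorem ElemKernel.integral_smul {Ω : Type*} {W : Set ℝ → Ω → ℝ} (c : ℝ) (φ : ElemKernel k)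
    (ω : Ω) :
    (φ.smul c).integral W ω = c * φ.integral W ω := by
  rw [integral, integral, Finset.mul_sum]
  exact Finset.sum_congr rfl fun i _ => mul_assoc _ _ _

theorem IsWienerIntegral.const_mul (h : IsWienerIntegral P W f Y) (c : ℝ) :
    IsWienerIntegral P W (fun x => c * f x) (fun ω => c * Y ω) := by
  obtain ⟨hf, hY, φ, h1, h2⟩ := h
  refine ⟨hf.const_mul c, hY.const_mul c, fun m => (φ m).smul c, ?_, ?_⟩
  · simp only [ElemKernel.toFun_smul, ← mul_sub]
    exact tendsto_eLpNorm_const_mul c h1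
  · simp only [ElemKernel.integral_smul, ← mul_sub]
    exact tendsto_eLpNorm_const_mul c h2

end WienerIntegral

/-! ### Affine changes of variable -/

section Affine

variable {k : ℕ}

theorem map_affine {r : ℝ} (hr : 0 < r) (d : ℝ) :
    Measure.map (fun x : Fin k → ℝ => fun l => r * x l + d) volume =
      ENNReal.ofReal ((r ^ k)⁻¹) • volume := by
  have h1 : (fun x : Fin k → ℝ => fun l => r * x l + d) =
      (fun x => x + fun _ => d) ∘ fun x : Fin k → ℝ => r • x := by
    ext x l; simp
  rw [h1, ← Measure.map_map (by fun_prop) (by fun_prop), Measure.map_addHaar_smul _ hr.ne',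
    Measure.map_smul, map_add_right_eq_self]
  simp only [Module.finrank_fin_fun]
  rw [abs_of_pos (by positivity)]

theorem tendsto_eLpNorm_comp_affine {r : ℝ} (hr : 0 < r) (d : ℝ) {u : ℕ → (Fin k → ℝ) → ℝ}
    (hu : ∀ m, AEStronglyMeasurable (u m) volume)
    (h : Tendsto (fun m => eLpNorm (u m) 2 volume) atTop (𝓝 0)) :
    Tendsto (fun m => eLpNorm (fun x : Fin k → ℝ => u m fun l => r * x l + d) 2 volume)
      atTop (𝓝 0) := by
  have h1 : ∀ m, eLpNorm (fun x : Fin k → ℝ => u m fun l => r * x l + d) 2 volume =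
      ENNReal.ofReal ((r ^ k)⁻¹) ^ (1 / (2 : ENNReal)).toReal * eLpNorm (u m) 2 volume := by
    intro m
    rw [← smul_eq_mul, ← eLpNorm_smul_measure_of_ne_top (by simp), ← map_affine hr d,
      eLpNorm_map_measure]
    · rfl
    · rw [map_affine hr d]
      exact (hu m).smul_measure _
    · exact (by fun_prop : Measurable fun x : Fin k → ℝ => fun l => r * x l + d).aemeasurable
  simp only [h1]
  have h2 := ENNReal.Tendsto.const_mul h (a := ENNReal.ofReal ((r ^ k)⁻¹) ^
    (1 / (2 : ENNReal)).toReal) (Or.inr (by simp))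
  rwa [mul_zero] at h2

theorem volume_preimage_affine {r : ℝ} (hr : 0 < r) (d : ℝ) (A : Set ℝ) :
    volume ((fun y => r * y + d) ⁻¹' A) = ENNReal.ofReal r⁻¹ * volume A := by
  have h1 : (fun y => r * y + d) ⁻¹' A = (r * ·) ⁻¹' ((· + d) ⁻¹' A) := rfl
  rw [h1, Real.volume_preimage_mul_left hr.ne', measure_preimage_add_right,
    abs_of_pos (by positivity)]

/-- The composition of an elementary kernel with an affine change of variable. -/
def ElemKernel.compAffine {r : ℝ} (hr : 0 < r) (d : ℝ) (φ : ElemKernel k) : ElemKernel k where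
  n := φ.n
  A j := (fun y => r * y + d) ⁻¹' φ.A j
  measurableSet_A j := (by fun_prop : Measurable fun y => r * y + d) (φ.measurableSet_A j)
  volume_A j := by
    rw [volume_preimage_affine hr]
    exact ENNReal.mul_ne_top ENNReal.ofReal_ne_top (φ.volume_A j)
  disjoint_A _ _ hij := (φ.disjoint_A hij).preimage _
  a := φ.a
  a_diag := φ.a_diag

variable {Ω : Type*} [MeasurableSpace Ω] {P : Measure Ω}

/-- Two centred Gaussian vectors with the same covariances have the same law. -/
theorem identDistrib_of_covariance_eq [IsProbabilityMeasure P] {κ : Type*} [Fintype κ]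
    {X Y : κ → Ω → ℝ}
    (hX : HasGaussianLaw (fun ω q => X q ω) P) (hY : HasGaussianLaw (fun ω q => Y q ω) P)
    (hX0 : ∀ q, P[X q] = 0) (hY0 : ∀ q, P[Y q] = 0)
    (hcov : ∀ q q', cov[X q, X q'; P] = cov[Y q, Y q'; P]) :
    IdentDistrib (fun ω q => X q ω) (fun ω q => Y q ω) P P := by
  classical
  refine ⟨hX.aemeasurable, hY.aemeasurable, ?_⟩
  have hL : ∀ (L : StrongDual ℝ (κ → ℝ)) (V : κ → Ω → ℝ),
      L ∘ (fun ω q => V q ω) = fun ω => ∑ q, L (Pi.single q 1) * V q ω := by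
    intro L V
    ext ω
    have h1 : (fun q => V q ω) = ∑ q, V q ω • (Pi.single q (1 : ℝ) : κ → ℝ) := by
      ext q
      simp [Finset.sum_apply, Pi.single_apply]
    simp only [Function.comp_apply]
    rw [h1, map_sum]
    refine Finset.sum_congr rfl fun q _ => ?_
    rw [map_smul, smul_eq_mul, mul_comm]
  have hmean : ∀ (L : StrongDual ℝ (κ → ℝ)) (V : κ → Ω → ℝ),
      HasGaussianLaw (fun ω q => V q ω) P → (∀ q, P[V q] = 0) →
      P[L ∘ fun ω q => V q ω] = 0 := by
    intro L V hV hV0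
    rw [hL, integral_finsetSum _ fun q _ => (hV.eval q).integrable.const_mul _]
    simp [integral_const_mul, hV0]
  have hvar : ∀ (L : StrongDual ℝ (κ → ℝ)) (V : κ → Ω → ℝ),
      HasGaussianLaw (fun ω q => V q ω) P →
      Var[L ∘ fun ω q => V q ω; P] = ∑ q, ∑ q', L (Pi.single q 1) *
        (L (Pi.single q' 1) * cov[V q, V q'; P]) := by
    intro L V hV
    rw [hL, variance_fun_sum fun q => (hV.eval q).memLp_two.const_mul _]
    refine Finset.sum_congr rfl fun q _ => Finset.sum_congr rfl fun q' _ => ?_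
    rw [covariance_const_mul_left, covariance_const_mul_right]
  have := hX.isGaussian_map
  have := hY.isGaussian_map
  refine Measure.ext_of_charFunDual (funext fun L => ?_)
  rw [hX.charFunDual_map_eq, hY.charFunDual_map_eq, hmean L X hX hX0, hmean L Y hY hY0,
    hvar L X hX, hvar L Y hY]
  simp only [hcov]

variable {W : Set ℝ → Ω → ℝ}

/-- Scaling of white noise under an affine change of variable. -/
theorem IsWhiteNoise.identDistrib_affine [IsProbabilityMeasure P] (hW : IsWhiteNoise P W) {r : ℝ}
    (hr : 0 < r) (d : ℝ)
    {κ : Type*} [Fintype κ] {A : κ → Set ℝ} (hA : ∀ q, MeasurableSet (A q))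
    (hA' : ∀ q, volume (A q) ≠ ⊤) :
    IdentDistrib (fun ω q => W ((fun y => r * y + d) ⁻¹' A q) ω)
      (fun ω q => √(r⁻¹) * W (A q) ω) P P := by
  have hB : ∀ q, MeasurableSet ((fun y => r * y + d) ⁻¹' A q) := fun q =>
    (by fun_prop : Measurable fun y => r * y + d) (hA q)
  have hB' : ∀ q, volume ((fun y => r * y + d) ⁻¹' A q) ≠ ⊤ := fun q => by
    rw [volume_preimage_affine hr]
    exact ENNReal.mul_ne_top ENNReal.ofReal_ne_top (hA' q)
  refine identDistrib_of_covariance_eq (X := fun q => W ((fun y => r * y + d) ⁻¹' A q))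
    (Y := fun q ω => √(r⁻¹) * W (A q) ω) (hW.hasGaussianLaw hB hB')
    ((hW.hasGaussianLaw hA hA').fun_smul √(r⁻¹)) (fun q => hW.mean _ (hB q) (hB' q)) (fun q => ?_)
    fun q q' => ?_
  · rw [integral_const_mul, hW.mean _ (hA q) (hA' q), mul_zero]
  · rw [hW.covariance_eq (hB q) (hB' q) (hB q') (hB' q'), covariance_const_mul_left,
      covariance_const_mul_right, hW.covariance_eq (hA q) (hA' q) (hA q') (hA' q'), ← mul_assoc,
      Real.mul_self_sqrt (by positivity), ← Set.preimage_inter, Measure.real,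
      volume_preimage_affine hr, ENNReal.toReal_mul, ENNReal.toReal_ofReal (by positivity)]
    rfl

theorem ElemKernel.identDistrib_affine [IsProbabilityMeasure P] (hW : IsWhiteNoise P W) {r : ℝ}
    (hr : 0 < r) (d : ℝ)
    {τ : Type*} [Fintype τ] (φ : τ → ElemKernel k) :
    IdentDistrib (fun ω t => ((φ t).compAffine hr d).integral W ω)
      (fun ω t => √(r⁻¹) ^ k * (φ t).integral W ω) P P := by
  have h := hW.identDistrib_affine hr d (κ := Σ t, Fin (φ t).n) (A := fun q => (φ q.1).A q.2)
    (fun q => (φ q.1).measurableSet_A _) (fun q => (φ q.1).volume_A _)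
  have hu : Measurable fun (v : (Σ t, Fin (φ t).n) → ℝ) t =>
      ∑ i : Fin k → Fin (φ t).n, (φ t).a i * ∏ l, v ⟨t, i l⟩ := by fun_prop
  have h1 : (fun ω t => √(r⁻¹) ^ k * (φ t).integral W ω) = fun ω t =>
      ∑ i : Fin k → Fin (φ t).n, (φ t).a i * ∏ l, (√(r⁻¹) * W ((φ t).A (i l)) ω) := by
    ext ω t
    simp only [integral, Finset.prod_mul_distrib, Finset.prod_const, Finset.card_univ,
      Fintype.card_fin, Finset.mul_sum, mul_left_comm]
  rw [h1]
  exact h.comp hu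

theorem tendstoInMeasure_pi_of_eLpNorm {τ : Type*} [Fintype τ] {X : ℕ → τ → Ω → ℝ} {Y : τ → Ω → ℝ}
    (hX : ∀ m t, AEStronglyMeasurable (X m t) P) (hY : ∀ t, AEStronglyMeasurable (Y t) P)
    (h : ∀ t, Tendsto (fun m => eLpNorm (fun ω => X m t ω - Y t ω) 2 P) atTop (𝓝 0)) :
    TendstoInMeasure P (fun m ω t => X m t ω) atTop (fun ω t => Y t ω) := by
  refine tendstoInMeasure_of_tendsto_eLpNorm (p := 2) two_ne_zero
    (fun m => (aemeasurable_pi_lambda _ fun t => (hX m t).aemeasurable).aestronglyMeasurable)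
    (aemeasurable_pi_lambda _ fun t => (hY t).aemeasurable).aestronglyMeasurable ?_
  have hs := tendsto_finsetSum (Finset.univ : Finset τ) fun t _ => h t
  rw [Finset.sum_const_zero] at hs
  refine tendsto_of_tendsto_of_tendsto_of_le_of_le tendsto_const_nhds hs (fun _ => zero_le)
    fun m => ?_
  have hm : ∀ t, AEStronglyMeasurable (fun ω => X m t ω - Y t ω) P := fun t =>
    (hX m t).sub (hY t)
  calc _ ≤ eLpNorm (∑ t, fun ω => ‖X m t ω - Y t ω‖) 2 P := by
        refine eLpNorm_mono_real fun ω => ?_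
        rw [pi_norm_le_iff_of_nonneg (by simp only [Finset.sum_apply]; positivity)]
        intro t
        rw [Finset.sum_apply]
        exact Finset.single_le_sum (f := fun t => ‖X m t ω - Y t ω‖) (fun _ _ => norm_nonneg _)
          (Finset.mem_univ t)
    _ ≤ ∑ t, eLpNorm (fun ω => ‖X m t ω - Y t ω‖) 2 P :=
        eLpNorm_sum_le (fun t _ => (hm t).norm) (by simp)
    _ = _ := Finset.sum_congr rfl fun t _ => eLpNorm_norm _

/-- Two sequences of random vectors with the same laws have limits with the same law. -/
theorem identDistrib_of_tendstoInMeasure [IsProbabilityMeasure P] {τ : Type*} [Fintype τ]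
    {X X' : ℕ → Ω → τ → ℝ}
    {Y Y' : Ω → τ → ℝ} (hX : TendstoInMeasure P X atTop Y) (hX' : TendstoInMeasure P X' atTop Y')
    (h : ∀ m, IdentDistrib (X m) (X' m) P P) : IdentDistrib Y Y' P P := by
  have h1 := hX.tendstoInDistribution fun m => (h m).aemeasurable_fst
  have h2 := hX'.tendstoInDistribution fun m => (h m).aemeasurable_snd
  have h3 : TendstoInDistribution X atTop Y' (fun _ => P) P := by
    refine ⟨fun m => (h m).aemeasurable_fst, h2.aemeasurable_limit, h2.tendsto.congr fun m => ?_⟩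
    exact Subtype.ext (h m).map_eq.symm
  exact ⟨h1.aemeasurable_limit, h2.aemeasurable_limit, tendstoInDistribution_unique X h1 h3⟩

/-- Composing kernels with `y ↦ r y + d` in every variable multiplies their Wiener-Itô integrals, in
joint law, by `r ^ (-k / 2)`. -/
theorem identDistrib_wienerIntegral_affine [IsProbabilityMeasure P] (hW : IsWhiteNoise P W) {r : ℝ}
    (hr : 0 < r) (d : ℝ)
    {τ : Type*} [Fintype τ] {f : τ → (Fin k → ℝ) → ℝ} {Y Y' : τ → Ω → ℝ}
    (hY : ∀ t, IsWienerIntegral P W (f t) (Y t))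
    (hY' : ∀ t, IsWienerIntegral P W (fun x => f t fun l => r * x l + d) (Y' t)) :
    IdentDistrib (fun ω t => Y' t ω) (fun ω t => √(r⁻¹) ^ k * Y t ω) P P := by
  have hφ : ∀ t, ∃ φ : ℕ → ElemKernel k,
      Tendsto (fun m => eLpNorm (fun x => (φ m).toFun x - f t x) 2 volume) atTop (𝓝 0) :=
    fun t => ElemKernel.exists_tendsto (hY t).1
  choose φ hφ using hφ
  have hφ' : ∀ t, Tendsto (fun m => eLpNorm (fun x => ((φ t m).compAffine hr d).toFun x -
      f t fun l => r * x l + d) 2 volume) atTop (𝓝 0) := fun t =>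
    tendsto_eLpNorm_comp_affine hr d (u := fun m x => (φ t m).toFun x - f t x)
      (fun m => (φ t m).measurable_toFun.aestronglyMeasurable.sub (hY t).1.1) (hφ t)
  have hX : TendstoInMeasure P (fun m ω t => ((φ t m).compAffine hr d).integral W ω) atTop
      (fun ω t => Y' t ω) :=
    tendstoInMeasure_pi_of_eLpNorm (X := fun m t => ((φ t m).compAffine hr d).integral W)
      (fun m t => (ElemKernel.memLp_integral hW _).1)
      (fun t => (hY' t).2.1.1) fun t => (hY' t).tendsto hW (hφ' t)
  have hX' : TendstoInMeasure P (fun m ω t => √(r⁻¹) ^ k * (φ t m).integral W ω) atTop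
      (fun ω t => √(r⁻¹) ^ k * Y t ω) := by
    refine tendstoInMeasure_pi_of_eLpNorm (X := fun m t ω => √(r⁻¹) ^ k * (φ t m).integral W ω)
      (Y := fun t ω => √(r⁻¹) ^ k * Y t ω)
      (fun m t => (ElemKernel.memLp_integral hW (φ t m)).1.const_mul _)
      (fun t => (hY t).2.1.1.const_mul _) fun t => ?_
    simp only [← mul_sub]
    exact tendsto_eLpNorm_const_mul _ ((hY t).tendsto hW (hφ t))
  exact identDistrib_of_tendstoInMeasure hX hX' fun m =>
    ElemKernel.identDistrib_affine hW hr d fun t => φ t m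

end Affine

/-! ### Translation and dilation of the tempered kernel -/

section Kernel

variable {k : ℕ} {α lam : ℝ} {g : (Fin k → ℝ) → ℝ}

theorem measurableSet_orthant : MeasurableSet (orthant k) := by
  have h : orthant k = ⋂ i, {x : Fin k → ℝ | 0 < x i} := by
    ext x; simp [orthant]
  rw [h]
  exact MeasurableSet.iInter fun i => measurableSet_lt measurable_const (measurable_pi_apply i)

theorem IsHermiteKernel.measurable_indicator (hg : IsHermiteKernel k α g) :
    Measurable ((orthant k).indicator g) := by
  refine measurable_of_restrict_of_restrict_compl measurableSet_orthant ?_ ?_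
  · convert hg.measurable using 1
    exact funext fun x => Set.indicator_of_mem x.2 g
  · convert (measurable_const : Measurable fun _ : ((orthant k)ᶜ : Set (Fin k → ℝ)) => (0 : ℝ))
      using 1
    exact funext fun x => Set.indicator_of_notMem x.2 g

theorem mul_mem_orthant_iff {c : ℝ} (hc : 0 < c) (y : Fin k → ℝ) :
    (fun i => c * y i) ∈ orthant k ↔ y ∈ orthant k := by
  simp [orthant, hc]

theorem IsHermiteKernel.indicator_mul (hg : IsHermiteKernel k α g) {c : ℝ} (hc : 0 < c)
    (y : Fin k → ℝ) :
    (orthant k).indicator g (fun i => c * y i) = c ^ α * (orthant k).indicator g y := by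
  by_cases hy : y ∈ orthant k
  · rw [Set.indicator_of_mem hy, Set.indicator_of_mem ((mul_mem_orthant_iff hc y).2 hy),
      hg.homogeneous c hc y hy]
  · rw [Set.indicator_of_notMem hy, Set.indicator_of_notMem (mt (mul_mem_orthant_iff hc y).1 hy),
      mul_zero]

theorem temperedIntegrand_eq (x : Fin k → ℝ) (s : ℝ) :
    temperedIntegrand g lam x s =
      (orthant k).indicator g (fun i => s - x i) * ∏ i, Real.exp (-lam * (s - x i)) := by
  unfold temperedIntegrand
  by_cases h : (fun i => s - x i) ∈ orthant k
  · simp [Set.indicator_of_mem h]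
  · simp [Set.indicator_of_notMem h]

theorem IsHermiteKernel.measurable_temperedIntegrand (hg : IsHermiteKernel k α g) :
    Measurable fun p : (Fin k → ℝ) × ℝ => temperedIntegrand g lam p.1 p.2 := by
  simp only [temperedIntegrand_eq]
  refine Measurable.mul (hg.measurable_indicator.comp ?_) ?_ <;> fun_prop

theorem enorm_temperedIntegrand_le (hlam : 0 < lam) (x : Fin k → ℝ) (s : ℝ) :
    ‖temperedIntegrand g lam x s‖ₑ ≤ ‖(orthant k).indicator g (fun i => s - x i)‖ₑ := by
  rw [temperedIntegrand_eq]
  by_cases h : (fun i => s - x i) ∈ orthant k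
  · rw [enorm_le_iff_norm_le, norm_mul]
    refine mul_le_of_le_one_right (norm_nonneg _) ?_
    rw [norm_prod]
    refine Finset.prod_le_one (fun _ _ => norm_nonneg _) fun i _ => ?_
    rw [Real.norm_eq_abs, Real.abs_exp, Real.exp_le_one_iff]
    have : 0 < s - x i := h i
    nlinarith
  · simp [Set.indicator_of_notMem h]

theorem temperedIntegrand_add (x : Fin k → ℝ) (s h : ℝ) :
    temperedIntegrand g lam x (s + h) = temperedIntegrand g lam (fun i => 1 * x i + -h) s := by
  unfold temperedIntegrand
  congr 1
  ext i
  ring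

/-- The increments of the kernel in `t` are its translates in `x`. Integrability is needed for
splitting the integral over `[0, t + h]`. -/
theorem temperedKernel_add_sub (x : Fin k → ℝ) (t h : ℝ)
    (h1 : IntervalIntegrable (temperedIntegrand g lam x) volume 0 (t + h))
    (h2 : IntervalIntegrable (temperedIntegrand g lam x) volume 0 h) :
    temperedKernel g lam (t + h) x - temperedKernel g lam h x =
      temperedKernel g lam t (fun i => 1 * x i + -h) := by
  unfold temperedKernel
  rw [intervalIntegral.integral_interval_sub_left h1 h2]
  simp only [← temperedIntegrand_add]
  rw [intervalIntegral.integral_comp_add_right (fun s => temperedIntegrand g lam x s), zero_add]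

theorem IsHermiteKernel.temperedIntegrand_mul (hg : IsHermiteKernel k α g) {c : ℝ} (hc : 0 < c)
    (x : Fin k → ℝ) (s : ℝ) :
    temperedIntegrand g lam x (c * s) =
      c ^ α * temperedIntegrand g (c * lam) (fun i => c⁻¹ * x i + 0) s := by
  have h : ∀ i, c * s - x i = c * (s - (c⁻¹ * x i + 0)) := fun i => by field_simp; ring
  simp only [temperedIntegrand_eq, h, hg.indicator_mul hc]
  rw [mul_assoc]
  congr 3
  ext i
  ring_nf

/-- Dilation of time: the substitution `s ↦ c s` contributes the factor `c`, the homogeneity of `g`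
the factor `c ^ α`, and `λ` becomes `c λ`. -/
theorem IsHermiteKernel.temperedKernel_mul (hg : IsHermiteKernel k α g) {c : ℝ} (hc : 0 < c)
    (x : Fin k → ℝ) (t : ℝ) :
    temperedKernel g lam (c * t) x =
      c ^ (α + 1) * temperedKernel g (c * lam) t (fun i => c⁻¹ * x i + 0) := by
  unfold temperedKernel
  have h := intervalIntegral.mul_integral_comp_mul_left (a := 0) (b := t)
    (f := temperedIntegrand g lam x) c
  rw [mul_zero] at h
  rw [← h]
  simp only [hg.temperedIntegrand_mul hc]
  rw [intervalIntegral.integral_const_mul, Real.rpow_add_one hc.ne']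
  ring

/-! ### Square integrability -/

theorem lintegral_abs_rpow_lt_top {β : ℝ} (hβ : -1 < β) (L : ℝ) :
    ∫⁻ v in Set.Icc (-L) L, ENNReal.ofReal (|v| ^ β) < ⊤ := by
  rcases lt_or_ge L 0 with hL | hL
  · rw [Set.Icc_eq_empty (by linarith)]
    simp
  set p : ℝ → ENNReal := (Set.Ioc 0 L).indicator fun v => ENNReal.ofReal (v ^ β) with hp
  have hpm : Measurable p := by
    refine Measurable.indicator ?_ measurableSet_Ioc
    exact (measurable_id.pow_const β).ennreal_ofReal
  have hfin : ∫⁻ v, p v < ⊤ := by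
    rw [hp, lintegral_indicator measurableSet_Ioc]
    have h := (intervalIntegral.intervalIntegrable_rpow' (a := 0) (b := L) hβ)
    rw [intervalIntegrable_iff_integrableOn_Ioc_of_le hL] at h
    exact h.setLIntegral_lt_top
  rw [← lintegral_indicator measurableSet_Icc]
  have hle : ∫⁻ v, (Set.Icc (-L) L).indicator (fun v => ENNReal.ofReal (|v| ^ β)) v ≤
      ∫⁻ v, (p v + p (-v)) := by
    refine lintegral_mono_ae ?_
    filter_upwards [Measure.ae_ne volume (0 : ℝ)] with v hv
    by_cases h : v ∈ Set.Icc (-L) L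
    · rw [Set.indicator_of_mem h]
      rcases lt_or_gt_of_ne hv with hneg | hpos
      · refine le_add_left ?_
        rw [hp, Set.indicator_of_mem (show -v ∈ Set.Ioc 0 L from ⟨by linarith, by linarith [h.1]⟩),
          abs_of_neg hneg]
      · refine le_add_right ?_
        rw [hp, Set.indicator_of_mem (show v ∈ Set.Ioc 0 L from ⟨hpos, h.2⟩), abs_of_pos hpos]
    · simp [Set.indicator_of_notMem h]
  refine hle.trans_lt ?_
  rw [lintegral_add_left hpm, lintegral_neg_eq_self (μ := volume) p]
  exact ENNReal.add_lt_top.2 ⟨hfin, hfin⟩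

/-- The correlation at lag `u` of the kernel, by homogeneity. -/
theorem IsHermiteKernel.lintegral_mul_translate (hg : IsHermiteKernel k α g) {u : ℝ} (hu : 0 < u) :
    ∫⁻ y, ‖(orthant k).indicator g y‖ₑ * ‖(orthant k).indicator g (fun i => u + y i)‖ₑ =
      ENNReal.ofReal (u ^ (2 * α + k)) *
        ∫⁻ y, ‖(orthant k).indicator g y‖ₑ * ‖(orthant k).indicator g (fun i => 1 + y i)‖ₑ := by
  have hgm := hg.measurable_indicator
  have hmeas : Measurable fun y =>
      ‖(orthant k).indicator g y‖ₑ * ‖(orthant k).indicator g (fun i => u + y i)‖ₑ :=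
    hgm.enorm.mul (hgm.comp (by fun_prop)).enorm
  -- Substitute `y ↦ u y`, with Jacobian `u ^ k`.
  have h1 := lintegral_map (μ := volume) hmeas
    (by fun_prop : Measurable fun x : Fin k → ℝ => fun l => u * x l + 0)
  rw [map_affine hu 0, lintegral_smul_measure] at h1
  have h2 : ∀ y : Fin k → ℝ, ‖(orthant k).indicator g (fun l => u * y l + 0)‖ₑ *
      ‖(orthant k).indicator g (fun i => u + (u * y i + 0))‖ₑ = ENNReal.ofReal (u ^ (2 * α)) *
        (‖(orthant k).indicator g y‖ₑ * ‖(orthant k).indicator g (fun i => 1 + y i)‖ₑ) := by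
    intro y
    have h3 : ∀ i, u + u * y i = u * (1 + y i) := fun i => by ring
    simp only [add_zero, h3]
    rw [hg.indicator_mul hu y, hg.indicator_mul hu fun i => 1 + y i, enorm_mul, enorm_mul]
    rw [mul_mul_mul_comm, two_mul, Real.rpow_add hu, ENNReal.ofReal_mul (by positivity),
      Real.enorm_of_nonneg (by positivity)]
  simp only [h2] at h1
  have hmeas' : Measurable fun y =>
      ‖(orthant k).indicator g y‖ₑ * ‖(orthant k).indicator g (fun i => 1 + y i)‖ₑ :=
    hgm.enorm.mul (hgm.comp (by fun_prop)).enorm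
  rw [lintegral_const_mul _ hmeas', smul_eq_mul] at h1
  have h4 : ENNReal.ofReal (u ^ k) * ENNReal.ofReal (u ^ k)⁻¹ = 1 := by
    rw [← ENNReal.ofReal_mul (by positivity), mul_inv_cancel₀ (by positivity), ENNReal.ofReal_one]
  rw [← one_mul (∫⁻ y, _), ← h4, mul_assoc, h1, ← mul_assoc, ← ENNReal.ofReal_mul (by positivity),
    Real.rpow_add hu, Real.rpow_natCast, mul_comm (u ^ k)]

/-- The correlation of the untempered kernels at times `s` and `s'`. The value at `s = s'` may be
infinite. -/
theorem IsHermiteKernel.lintegral_mul (hg : IsHermiteKernel k α g) {s s' : ℝ} (h : s ≠ s') :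
    ∫⁻ x : Fin k → ℝ, ‖(orthant k).indicator g (fun i => s - x i)‖ₑ *
        ‖(orthant k).indicator g (fun i => s' - x i)‖ₑ =
      ENNReal.ofReal (|s' - s| ^ (2 * α + k)) *
        ∫⁻ y, ‖(orthant k).indicator g y‖ₑ * ‖(orthant k).indicator g (fun i => 1 + y i)‖ₑ := by
  wlog hlt : s < s' generalizing s s'
  · rw [abs_sub_comm, ← this h.symm (lt_of_le_of_ne (not_lt.1 hlt) h.symm)]
    exact lintegral_congr fun x => mul_comm _ _
  rw [abs_of_pos (sub_pos.2 hlt), ← hg.lintegral_mul_translate (sub_pos.2 hlt),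
    ← lintegral_sub_left_eq_self _ (fun _ : Fin k => s)]
  refine lintegral_congr fun x => ?_
  have h₁ : (fun i => s - ((fun _ => s : Fin k → ℝ) - x) i) = x := by ext i; simp
  have h₂ : (fun i => s' - ((fun _ => s : Fin k → ℝ) - x) i) = fun i => s' - s + x i := by
    ext i
    simp only [Pi.sub_apply]
    ring
  rw [h₁, h₂]

/-- The integrability condition at `u = 0`, where it is free of the tempering parameter. -/
theorem TemperedIntegrable.lintegral_lt_top (hT : TemperedIntegrable k lam g) :
    ∫⁻ y, ‖(orthant k).indicator g y‖ₑ * ‖(orthant k).indicator g (fun i => 1 + y i)‖ₑ < ⊤ := by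
  refine lt_of_le_of_lt (le_of_eq ?_) (hT 0 le_rfl)
  rw [← lintegral_indicator measurableSet_orthant]
  refine lintegral_congr fun y => ?_
  by_cases hy : y ∈ orthant k
  · have hy' : (fun i => 1 + y i) ∈ orthant k := fun i => add_pos one_pos (hy i)
    rw [Set.indicator_of_mem hy, Set.indicator_of_mem hy, Set.indicator_of_mem hy', ← enorm_mul,
      ← ofReal_norm]
    simp
  · simp [Set.indicator_of_notMem hy]

/-- The absolute kernel is square integrable: by Tonelli, its square integrates to the double
integral of the correlations, which is finite because `2 α + k > -1`. -/
theorem IsHermiteKernel.lintegral_sq_lt_top (hg : IsHermiteKernel k α g)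
    (hT : TemperedIntegrable k lam g) (t : ℝ) :
    ∫⁻ x : Fin k → ℝ,
      (∫⁻ s in Set.uIoc 0 t, ‖(orthant k).indicator g (fun i => s - x i)‖ₑ) ^ 2 < ⊤ := by
  have hgm := hg.measurable_indicator
  set M := ∫⁻ y, ‖(orthant k).indicator g y‖ₑ * ‖(orthant k).indicator g (fun i => 1 + y i)‖ₑ
  set B := ∫⁻ v in Set.Icc (-|t|) |t|, ENNReal.ofReal (|v| ^ (2 * α + k))
  have hB : B < ⊤ := lintegral_abs_rpow_lt_top (by linarith [hg.lower]) _
  have hq : Measurable fun p : (Fin k → ℝ) × ℝ =>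
      ‖(orthant k).indicator g (fun i => p.2 - p.1 i)‖ₑ := (hgm.comp (by fun_prop)).enorm
  have h1 : ∀ x : Fin k → ℝ,
      (∫⁻ s in Set.uIoc 0 t, ‖(orthant k).indicator g (fun i => s - x i)‖ₑ) ^ 2 =
        ∫⁻ s in Set.uIoc 0 t, ∫⁻ s' in Set.uIoc 0 t,
          ‖(orthant k).indicator g (fun i => s - x i)‖ₑ *
            ‖(orthant k).indicator g (fun i => s' - x i)‖ₑ := by
    intro x
    have hqx : Measurable fun s : ℝ => ‖(orthant k).indicator g (fun i => s - x i)‖ₑ :=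
      hq.comp (measurable_const.prodMk measurable_id)
    rw [sq, ← lintegral_mul_const _ hqx]
    exact lintegral_congr fun s => (lintegral_const_mul _ hqx).symm
  have hq3 : Measurable fun p : ((Fin k → ℝ) × ℝ) × ℝ =>
      ‖(orthant k).indicator g (fun i => p.1.2 - p.1.1 i)‖ₑ *
        ‖(orthant k).indicator g (fun i => p.2 - p.1.1 i)‖ₑ :=
    (hgm.comp (by fun_prop)).enorm.mul (hgm.comp (by fun_prop)).enorm
  simp only [h1]
  rw [lintegral_lintegral_swap hq3.lintegral_prod_right'.aemeasurable]
  have h2 : ∀ s ∈ Set.uIoc 0 t, (∫⁻ x : Fin k → ℝ, ∫⁻ s' in Set.uIoc 0 t,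
      ‖(orthant k).indicator g (fun i => s - x i)‖ₑ *
        ‖(orthant k).indicator g (fun i => s' - x i)‖ₑ) ≤ M * B := by
    intro s hs
    have hm : Measurable fun p : (Fin k → ℝ) × ℝ =>
      ‖(orthant k).indicator g (fun i => s - p.1 i)‖ₑ *
        ‖(orthant k).indicator g (fun i => p.2 - p.1 i)‖ₑ :=
      (hgm.comp (by fun_prop)).enorm.mul (hgm.comp (by fun_prop)).enorm
    rw [lintegral_lintegral_swap hm.aemeasurable]
    -- For `s, s'` in the interval between `0` and `t` the lag is at most `|t|`.
    have h3 : ∀ᵐ s' ∂(volume.restrict (Set.uIoc 0 t)), (∫⁻ x : Fin k → ℝ,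
        ‖(orthant k).indicator g (fun i => s - x i)‖ₑ *
          ‖(orthant k).indicator g (fun i => s' - x i)‖ₑ) =
        M * (Set.Icc (-|t|) |t|).indicator
          (fun v => ENNReal.ofReal (|v| ^ (2 * α + k))) (s' - s) := by
      filter_upwards [ae_restrict_of_ae (Measure.ae_ne volume s),
        ae_restrict_mem measurableSet_uIoc] with s' hne hs'
      rw [hg.lintegral_mul hne.symm, mul_comm, Set.indicator_of_mem]
      rw [Set.mem_Icc, ← abs_le]
      simpa using Set.abs_sub_le_of_uIcc_subset_uIcc
        (Set.uIcc_subset_uIcc (Set.uIoc_subset_uIcc hs) (Set.uIoc_subset_uIcc hs'))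
    rw [lintegral_congr_ae h3]
    refine (setLIntegral_le_lintegral _ _).trans (le_of_eq ?_)
    rw [lintegral_sub_right_eq_self (fun v => M * (Set.Icc (-|t|) |t|).indicator
      (fun v => ENNReal.ofReal (|v| ^ (2 * α + k))) v) s, lintegral_const_mul,
      lintegral_indicator measurableSet_Icc]
    refine Measurable.indicator ?_ measurableSet_Icc
    exact (measurable_id.abs.pow_const _).ennreal_ofReal
  refine (setLIntegral_mono' measurableSet_uIoc h2).trans_lt ?_
  rw [setLIntegral_const, Real.volume_uIoc]
  exact ENNReal.mul_lt_top (ENNReal.mul_lt_top hT.lintegral_lt_top hB) ENNReal.ofReal_lt_top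

theorem IsHermiteKernel.ae_intervalIntegrable (hg : IsHermiteKernel k α g)
    (hT : TemperedIntegrable k lam g) {lam' : ℝ} (hlam' : 0 < lam') (t : ℝ) :
    ∀ᵐ x : Fin k → ℝ, IntervalIntegrable (temperedIntegrand g lam' x) volume 0 t := by
  have hq : Measurable fun p : (Fin k → ℝ) × ℝ =>
      ‖(orthant k).indicator g (fun i => p.2 - p.1 i)‖ₑ :=
    (hg.measurable_indicator.comp (by fun_prop)).enorm
  filter_upwards [ae_lt_top (hq.lintegral_prod_right'.pow_const 2)
    (hg.lintegral_sq_lt_top hT t).ne] with x hx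
  rw [intervalIntegrable_iff]
  refine ⟨(hg.measurable_temperedIntegrand.comp
    (measurable_const.prodMk measurable_id)).aestronglyMeasurable, ?_⟩
  refine (lintegral_mono fun s => enorm_temperedIntegrand_le hlam' x s).trans_lt ?_
  by_contra h
  rw [not_lt, top_le_iff] at h
  simp [h] at hx

theorem IsHermiteKernel.memLp_temperedKernel (hg : IsHermiteKernel k α g)
    (hT : TemperedIntegrable k lam g) {lam' : ℝ} (hlam' : 0 < lam') (t : ℝ) :
    MemLp (temperedKernel g lam' t) 2 volume := by
  have hm : StronglyMeasurable fun x => ∫ s in Set.uIoc 0 t, temperedIntegrand g lam' x s :=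
    (hg.measurable_temperedIntegrand (lam := lam')).stronglyMeasurable.integral_prod_right'
  have heq : temperedKernel g lam' t = fun x =>
      (if 0 ≤ t then 1 else -1 : ℝ) • ∫ s in Set.uIoc 0 t, temperedIntegrand g lam' x s := by
    ext x
    exact intervalIntegral.intervalIntegral_eq_integral_uIoc _ _ _ _
  rw [heq]
  refine MemLp.const_smul (𝕜 := ℝ) ⟨hm.aestronglyMeasurable, ?_⟩ _
  rw [eLpNorm_lt_top_iff_lintegral_rpow_enorm_lt_top two_ne_zero (by simp)]
  refine lt_of_le_of_lt (lintegral_mono fun x => ?_) (hg.lintegral_sq_lt_top hT t)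
  simp only [ENNReal.toReal_ofNat, ENNReal.rpow_two]
  gcongr
  exact (enorm_integral_le_lintegral_enorm _).trans
    (lintegral_mono fun s => enorm_temperedIntegrand_le hlam' x s)

end Kernel

/-! ### The tempered generalized Hermite process -/

section Law

variable {k : ℕ} {Ω : Type*} [MeasurableSpace Ω] {P : Measure Ω} {W : Set ℝ → Ω → ℝ} {α lam : ℝ}
  {g : (Fin k → ℝ) → ℝ} {Z : ℝ → Ω → ℝ}

theorem IsTemperedHermiteProcess.hasStationaryIncrements [IsProbabilityMeasure P]
    (hW : IsWhiteNoise P W) (hZ : IsTemperedHermiteProcess P W g lam Z) :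
    HasStationaryIncrements P Z := by
  intro h I
  have hY : ∀ t : I, IsWienerIntegral P W (temperedKernel g lam t) (fun ω => Z t ω - Z 0 ω) :=
    fun t => ((hZ t).2.sub hW (hZ 0).2).congr_ae
      (Eventually.of_forall fun x => by simp [temperedKernel])
  have hY' : ∀ t : I, IsWienerIntegral P W
      (fun x => temperedKernel g lam t fun i => 1 * x i + -h)
      (fun ω => Z (t + h) ω - Z h ω) := fun t =>
    ((hZ (t + h)).2.sub hW (hZ h).2).congr_ae (by
      filter_upwards [(hZ (t + h)).1, (hZ h).1] with x h1 h2
      exact temperedKernel_add_sub x t h h1 h2)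
  simpa using identDistrib_wienerIntegral_affine hW one_pos (-h) hY hY'

theorem IsTemperedHermiteProcess.eqFDD_mul [IsProbabilityMeasure P] (hW : IsWhiteNoise P W)
    (hg : IsHermiteKernel k α g) (hZ : IsTemperedHermiteProcess P W g lam Z) {c : ℝ} (hc : 0 < c)
    {Z' : ℝ → Ω → ℝ} (hZ' : IsTemperedHermiteProcess P W g (c * lam) Z') :
    EqFDD P (fun t ω => Z (c * t) ω) (fun t ω => c ^ (α + 1 + (k : ℝ) / 2) * Z' t ω) := by
  intro I
  have hY : ∀ t : I, IsWienerIntegral P W (fun x => c ^ (α + 1) * temperedKernel g (c * lam) t x)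
      (fun ω => c ^ (α + 1) * Z' t ω) := fun t => (hZ' t).2.const_mul _
  have hY' : ∀ t : I, IsWienerIntegral P W
      (fun x => c ^ (α + 1) * temperedKernel g (c * lam) t fun i => c⁻¹ * x i + 0)
      (Z (c * t)) := fun t => (hZ (c * t)).2.congr_ae
        (Eventually.of_forall fun x => hg.temperedKernel_mul hc x t)
  have h := identDistrib_wienerIntegral_affine hW (inv_pos.2 hc) 0 hY hY'
  have hpow : √(c⁻¹⁻¹) ^ k * c ^ (α + 1) = c ^ (α + 1 + (k : ℝ) / 2) := by
    rw [inv_inv, Real.sqrt_eq_rpow, ← Real.rpow_natCast, ← Real.rpow_mul hc.le, ← Real.rpow_add hc]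
    congr 1
    ring
  simpa only [← mul_assoc, hpow] using h

theorem IsHermiteKernel.exists_isTemperedHermiteProcess [IsProbabilityMeasure P]
    (hW : IsWhiteNoise P W) (hg : IsHermiteKernel k α g) (hT : TemperedIntegrable k lam g)
    {lam' : ℝ} (hlam' : 0 < lam') : ∃ Z, IsTemperedHermiteProcess P W g lam' Z := by
  choose Z hZ using fun t => exists_isWienerIntegral hW (hg.memLp_temperedKernel hT hlam' t)
  exact ⟨Z, fun t => ⟨hg.ae_intervalIntegrable hT hlam' t, hZ t⟩⟩

end Law

end TemperedHermite

end
theorem lemma3p2 {Ω : Type*} [MeasurableSpace Ω] (P : Measure Ω) [IsProbabilityMeasure P]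
    (W : Set ℝ → Ω → ℝ) (hW : TemperedHermite.IsWhiteNoise P W)
    (k : ℕ) (hk : 1 ≤ k) (H α : ℝ) (hH : 1 / 2 < H) (hα : α + 1 = H - (k : ℝ) / 2)
    (g : (Fin k → ℝ) → ℝ) (hg : TemperedHermite.IsHermiteKernel k α g)
    (lam : ℝ) (hlam : 0 < lam) :
    -- the processes exist when the kernel satisfies the integrability condition
    (TemperedHermite.TemperedIntegrable k lam g →
      ∀ c : ℝ, 0 < c →
        ∃ Z : ℝ → Ω → ℝ, TemperedHermite.IsTemperedHermiteProcess P W g (c * lam) Z) ∧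
    -- stationary increments, and the tempered scaling property
    (∀ Z : ℝ → Ω → ℝ, TemperedHermite.IsTemperedHermiteProcess P W g lam Z →
      TemperedHermite.HasStationaryIncrements P Z ∧
      ∀ c : ℝ, 0 < c → ∀ Z' : ℝ → Ω → ℝ,
        TemperedHermite.IsTemperedHermiteProcess P W g (c * lam) Z' →
          TemperedHermite.EqFDD P (fun t ω => Z (c * t) ω) (fun t ω => c ^ H * Z' t ω)) := by
  refine ⟨fun hT c hc => hg.exists_isTemperedHermiteProcess hW hT (mul_pos hc hlam),
    fun Z hZ => ⟨hZ.hasStationaryIncrements hW, fun c hc Z' hZ' => ?_⟩⟩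
  have h := hZ.eqFDD_mul hW hg hc hZ'
  rwa [show α + 1 + (k : ℝ) / 2 = H by rw [hα]; ring] at h
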